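/- Let $n\ge 3$, $K\ge 2$, $1\le i\le n$ and $a\in\mathbb{C}^*$. For odd $L$ let $M_L(Z_L)$ be the lower unitriangular, and for even $L$ the upper unitriangular $n\times n$ matrix whose off-diagonal entries in the triangle are the independent complex variables $Z_L=(z_{L,kl})$ ($k>l$ for odd $L$, $k<l$ for even $L$). Put $$P^K(Z_1,\dots,Z_K)=(P^K_1,\dots,P^K_n)=e_n^T M_1(Z_1)^{-1}\cdots M_K(Z_K)^{-1},\qquad \mathcal{G}=\{Z\in(\mathbb{C}^{n(n-1)/2})^K: P^K_i(Z)=a\},$$ and assume that the fiber $\mathcal{G}$ is smooth, i.e. $dP^K_i\neq 0$ at every point of $\mathcal{G}$. For holomorphic vector fields on a closed complex submanifold $X$ of some $\mathbb{C}^N$, call an ordered tuple $(\theta_1,\dots,\theta_m)$ of $\mathbb{C}$-complete fields *compatible* if 1. there is a non-zero ideal $I\subset\mathcal{O}(X)$ contained in the closure (compact-open topology) of the linear span of the products $f_1\cdots f_m$ with $f_j\in\ker\theta_j$, and 2. there are a rooted directed tree $G$ oriented towards its root, a bijection $\pi:\mathrm{Vert}(G)\to\{\theta_1,\dots,\theta_m\}$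 with $\pi(\mathrm{root})=\theta_1$, and a map $\epsilon:\mathrm{Edges}(G)\to\mathcal{O}(X)$ with $\epsilon(v,w)\in(\ker\pi(v)^2\setminus\ker\pi(v))\cap\ker\pi(w)$ for every edge from $v$ to $w$. Then the formulas $$V_1=\frac{\partial P^K_i}{\partial z_{1,n2}}\frac{\partial}{\partial z_{1,n1}}-\frac{\partial P^K_i}{\partial z_{1,n1}}\frac{\partial}{\partial z_{1,n2}},\qquad V_2=\frac{\partial P^K_i}{\partial z_{2,2n}}\frac{\partial}{\partial z_{2,1n}}-\frac{\partial P^K_i}{\partial z_{2,1n}}\frac{\partial}{\partial z_{2,2n}}$$ define holomorphic vector fields on $\mathcal{G}$. These are locally nilpotent (every regular function on $\mathcal{G}$ is annihilated by a power of the field) and $\mathbb{C}$-complete, and $(V_2,V_1)$ is a compatible $2$-tuple; its tree may be taken with root $V_2$, the single edge from $V_1$ to $V_2$, and edge function $\epsilon(V_1,V_2)=z_{1,n2}$. -/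

import Mathlib

open Topology Filter

namespace GromovVaserstein

noncomputable section

/-! ## Holomorphic functions and vector fields on a closed complex submanifold `X` of `E = ℂ^N`

Stein manifolds are treated as closed complex submanifolds `X` of a complex vector space. -/

section Holomorphic

variable {E : Type} [NormedAddCommGroup E] [NormedSpace ℂ E]

/-- A map on `X` is holomorphic if near each point of `X` it is the restriction of a holomorphic
map of the ambient space. -/
def IsHol {F : Type} [NormedAddCommGroup F] [NormedSpace ℂ F] (X : Set E) (f : X → F) : Prop :=
  ∀ x : X, ∃ g : E → F, AnalyticAt ℂ g x ∧ ∀ᶠ y : X in 𝓝 x, g y = f y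

/-- The algebra `𝒪(X)` of holomorphic functions, with the compact-open topology
(it inherits the topology of `C(X, ℂ)`). -/
def HolFun (X : Set E) : Subalgebra ℂ C(X, ℂ) where
  carrier := {f | IsHol X f}
  mul_mem' := by
    intro f g hf hg x
    obtain ⟨F, hF, hFf⟩ := hf x
    obtain ⟨G, hG, hGg⟩ := hg x
    refine ⟨F * G, hF.mul hG, ?_⟩
    filter_upwards [hFf, hGg] with y h1 h2
    simp [h1, h2]
  add_mem' := by
    intro f g hf hg x
    obtain ⟨F, hF, hFf⟩ := hf x
    obtain ⟨G, hG, hGg⟩ := hg x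
    refine ⟨F + G, hF.add hG, ?_⟩
    filter_upwards [hFf, hGg] with y h1 h2
    simp [h1, h2]
  algebraMap_mem' := by
    intro c x
    exact ⟨fun _ => c, analyticAt_const, Eventually.of_forall fun y => rfl⟩

/-- The tangent space `T_x X`: the vectors that annihilate (the differentials of) all
holomorphic germs at `x` vanishing on `X`. -/
def tangentSpace (X : Set E) (x : E) : Set E :=
  {v | ∀ g : E → ℂ, AnalyticAt ℂ g x → (∀ᶠ y in 𝓝[X] x, g y = 0) → fderiv ℂ g x v = 0}

/-- Holomorphic vector fields on `X`. -/
structure HolVF (X : Set E) where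
  toFun : X → E
  holomorphic : IsHol X toFun
  tangent : ∀ x : X, toFun x ∈ tangentSpace X x

namespace HolVF

variable {X : Set E}

/-- The derivative of `f` at `x` along `V`, computed with a local holomorphic extension of `f`;
`derivAt_eq` shows that the choice of the extension does not matter. -/
def derivAt (V : HolVF X) (f : HolFun X) (x : X) : ℂ :=
  fderiv ℂ (Classical.choose (f.2 x)) x (V.toFun x)

theorem derivAt_eq (V : HolVF X) (f : HolFun X) (x : X) (g : E → ℂ) (hg : AnalyticAt ℂ g x)
    (hgf : ∀ᶠ y : X in 𝓝 x, g y = f.1 y) : V.derivAt f x = fderiv ℂ g x (V.toFun x) := by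
  obtain ⟨h1, h2⟩ := Classical.choose_spec (f.2 x)
  have h3 := V.tangent x _ (h1.sub hg) (by
    rw [nhdsWithin_eq_map_subtype_coe x.2, eventually_map]
    filter_upwards [h2, hgf] with y ha hb
    simp only [Pi.sub_apply]
    rw [ha, hb, sub_self])
  rw [fderiv_sub h1.differentiableAt hg.differentiableAt] at h3
  exact sub_eq_zero.1 h3

theorem isHol_derivAt (V : HolVF X) (f : HolFun X) : IsHol X (V.derivAt f) := by
  intro x
  obtain ⟨g, hg, hgf⟩ := f.2 x
  obtain ⟨W, hW, hWV⟩ := V.holomorphic x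
  refine ⟨fun y => fderiv ℂ g y (W y), 
    ((ContinuousLinearMap.apply ℂ ℂ).flip.analyticAt_bilinear (fderiv ℂ g x, W x)).comp₂ hg.fderiv hW, ?_⟩
  have h1 : ∀ᶠ y : X in 𝓝 x, AnalyticAt ℂ g y :=
    continuous_subtype_val.continuousAt.eventually hg.eventually_analyticAt
  filter_upwards [h1, hWV, hgf.eventually_nhds] with y ha hb hc
  rw [V.derivAt_eq f y g ha hc, hb]

theorem _root_.GromovVaserstein.IsHol.continuous {f : X → ℂ} (hf : IsHol X f) :
    Continuous f := by
  rw [continuous_iff_continuousAt]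
  intro x
  obtain ⟨g, hg, hgf⟩ := hf x
  have h : ContinuousAt (fun y : X => g y) x :=
    ContinuousAt.comp (f := ((↑) : X → E)) hg.continuousAt continuous_subtype_val.continuousAt
  exact h.congr hgf

/-- The action of a holomorphic vector field on `𝒪(X)`. -/
def lie (V : HolVF X) : HolFun X →ₗ[ℂ] HolFun X where
  toFun f := ⟨⟨V.derivAt f, (V.isHol_derivAt f).continuous⟩, V.isHol_derivAt f⟩
  map_add' f g := by
    ext x
    obtain ⟨F, hF, hFf⟩ := f.2 x
    obtain ⟨G, hG, hGg⟩ := g.2 x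
    change V.derivAt (f + g) x = V.derivAt f x + V.derivAt g x
    rw [V.derivAt_eq f x F hF hFf, V.derivAt_eq g x G hG hGg,
      V.derivAt_eq (f + g) x (F + G) (hF.add hG) (by
        filter_upwards [hFf, hGg] with y h1 h2
        simp [h1, h2]),
      fderiv_add hF.differentiableAt hG.differentiableAt]
    rfl
  map_smul' c f := by
    ext x
    obtain ⟨F, hF, hFf⟩ := f.2 x
    change V.derivAt (c • f) x = c * V.derivAt f x
    rw [V.derivAt_eq f x F hF hFf,
      V.derivAt_eq (c • f) x (c • F) (hF.const_smul) (by
        filter_upwards [hFf] with y h1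
        simp [h1]),
      fderiv_const_smul hF.differentiableAt]
    rfl

/-- `V` is `ℂ`-complete: through every point passes an integral curve in `X` that is defined for
all complex times. -/
def IsComplete (V : HolVF X) : Prop :=
  ∀ x : X, ∃ γ : ℂ → X, γ 0 = x ∧ ∀ t, HasDerivAt (fun s => (γ s : E)) (V.toFun (γ t)) t

end HolVF

/-- The set `(ker V² \ ker V) ∩ ker W` of functions allowed on an edge from `V` to `W`. -/
def edgeFunctions {X : Set E} (V W : HolVF X) : Set (HolFun X) :=
  {f | V.lie (V.lie f) = 0 ∧ V.lie f ≠ 0 ∧ W.lie f = 0}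

/-- `G` is a rooted directed tree with orientation towards the root: no edge leaves the root,
exactly one edge leaves each other vertex, and the root can be reached from every vertex. -/
structure IsRootedTree {W : Type} (G : Digraph W) (root : W) : Prop where
  root_out : ∀ w, ¬ G.Adj root w
  out_unique : ∀ v, v ≠ root → ∃! w, G.Adj v w
  reach : ∀ v, Relation.ReflTransGen G.Adj v root

/-- `(G, π, ε)` is an admissible rooted tree for the tuple `θ`; the entry `θ 0` (the first one)
sits at the root. -/
structure IsAdmissibleTree {X : Set E} {n : ℕ} (θ : Fin (n + 1) → HolVF X) {W : Type}
    (G : Digraph W) (root : W) (π : W → HolVF X) (ε : W → W → HolFun X) : Prop where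
  tree : IsRootedTree G root
  bij : Set.BijOn π Set.univ (Set.range θ)
  root_eq : π root = θ 0
  edge : ∀ v w, G.Adj v w → ε v w ∈ edgeFunctions (π v) (π w)

/-- The ordered tuple `θ` of holomorphic vector fields is a compatible tuple: all entries are
complete, the closure of the span of the products of kernel elements contains a non-zero ideal
of `𝒪(X)`, and there is an admissible rooted tree. -/
structure IsCompatible {X : Set E} {n : ℕ} (θ : Fin (n + 1) → HolVF X) : Prop where
  complete : ∀ j, (θ j).IsComplete
  ideal : ∃ I : Ideal (HolFun X), I ≠ ⊥ ∧
    (I : Set (HolFun X)) ⊆ closure (Submodule.span ℂ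
      {f : HolFun X | ∃ g : Fin (n + 1) → HolFun X, (∀ j, (θ j).lie (g j) = 0) ∧ f = ∏ j, g j} :
        Set (HolFun X))
  tree : ∃ (W : Type) (G : Digraph W) (root : W) (π : W → HolVF X) (ε : W → W → HolFun X),
    IsAdmissibleTree θ G root π ε

/-- The directed graph on two vertices with the single edge `1 → 0`. -/
def oneEdge : Digraph (Fin 2) where
  Adj v w := v = 1 ∧ w = 0

end Holomorphic

/-- `V` is locally nilpotent: each regular function on `X ⊆ ℂ^σ` (restriction of a polynomial) is
annihilated by some power of `V`. -/
def IsLocallyNilpotent {σ : Type} [Fintype σ] {X : Set (σ → ℂ)} (V : HolVF X) : Prop :=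
  ∀ f : HolFun X, (∃ p : MvPolynomial σ ℂ, ∀ x : X, f.1 x = MvPolynomial.eval x.1 p) →
    ∃ k : ℕ, (V.lie ^ k) f = 0

/-! ## The Gromov--Vaserstein fibration for the special linear group

All indices are shifted by one: the factor number `L` of the text is `L - 1 : Fin K`, so that the
odd (lower triangular) factors are those with even `L : Fin K`, and rows and columns are
numbered by `Fin n`. -/

/-- The positions `(L, k, l)` of the variables `z_{L,kl}`: `k > l` in a lower triangular factor,
`k < l` in an upper triangular one. -/
def IsPos (K n : ℕ) (q : Fin K × Fin n × Fin n) : Prop :=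
  if Even (q.1 : ℕ) then q.2.2 < q.2.1 else q.2.1 < q.2.2

instance (K n : ℕ) : DecidablePred (IsPos K n) := fun q => by unfold IsPos; infer_instance

/-- Index set of the variables; `(Idx K n → ℂ)` is `(ℂ^{n(n-1)/2})^K`. -/
abbrev Idx (K n : ℕ) : Type := {q : Fin K × Fin n × Fin n // IsPos K n q}

/-- The unitriangular matrix `M_L(Z_L)`. -/
def M {K n : ℕ} (L : Fin K) (Z : Idx K n → ℂ) : Matrix (Fin n) (Fin n) ℂ :=
  Matrix.of fun k l => if k = l then 1 else if h : IsPos K n (L, k, l) then Z ⟨(L, k, l), h⟩ else 0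

/-- The last standard basis vector `e_n`. -/
def eLast (n : ℕ) : Fin n → ℂ := fun k => if (k : ℕ) + 1 = n then 1 else 0

/-- `P^K(Z) = e_nᵀ M_1(Z_1)⁻¹ ⋯ M_K(Z_K)⁻¹`. -/
def P (K n : ℕ) (Z : Idx K n → ℂ) : Fin n → ℂ :=
  Matrix.vecMul (eLast n) (List.ofFn fun L : Fin K => (M L Z)⁻¹).prod

/-- `𝒢 = {Z : P_i^K(Z) = a}`. -/
def fiber (K n : ℕ) (i : Fin n) (a : ℂ) : Set (Idx K n → ℂ) := {Z | P K n Z i = a}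

/-- `∂P_i^K / ∂z_q`. -/
def dP (K n : ℕ) (i : Fin n) (q : Idx K n) (Z : Idx K n → ℂ) : ℂ :=
  fderiv ℂ (fun Z' => P K n Z' i) Z (Pi.single q 1)

/-- `∂P_i^K/∂z_r · ∂/∂z_q - ∂P_i^K/∂z_q · ∂/∂z_r`. -/
def pairField (K n : ℕ) (i : Fin n) (q r : Idx K n) (Z : Idx K n → ℂ) : Idx K n → ℂ :=
  dP K n i r Z • Pi.single q 1 - dP K n i q Z • Pi.single r 1

/-- The variable `z_{1,nj}`, `j < n` (with `j : ℕ` counted from one). -/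
def idx₁ {K n : ℕ} (hK : 2 ≤ K) (j : ℕ) (hj : 1 ≤ j ∧ j < n) : Idx K n :=
  ⟨(⟨0, by omega⟩, ⟨n - 1, by omega⟩, ⟨j - 1, by omega⟩), by
    simp only [IsPos, Even.zero, if_true, Fin.mk_lt_mk]; omega⟩

/-- The variable `z_{2,jn}`, `j < n` (with `j : ℕ` counted from one). -/
def idx₂ {K n : ℕ} (hK : 2 ≤ K) (j : ℕ) (hj : 1 ≤ j ∧ j < n) : Idx K n :=
  ⟨(⟨1, by omega⟩, ⟨j - 1, by omega⟩, ⟨n - 1, by omega⟩), by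
    simp only [IsPos, Nat.not_even_one, if_false, Fin.mk_lt_mk]; omega⟩

end

end GromovVaserstein

open GromovVaserstein

/-! Both fields move two variables of one factor that stand in the same row or the same column.
Since the inverse of a triangular matrix is triangular, `P_i` is jointly affine in such a pair, with
no mixed term (`exists_P_add_single_add_single`). Hence the two partial derivatives are constant
along `τ ↦ Z + τ V(Z)`, this line stays in the fiber, and it is the integral curve
(`HolVF.HasLinearFlow`). Completeness is then immediate. A polynomial restricted to the line is a
polynomial in `τ` of bounded degree, which gives local nilpotency.

The edge function `z_{1,n2}` satisfies `V₁ f = -∂P_i/∂z_{1,n1}`, which is invariant under `V₁` and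
not identically zero on the fiber (`exists_mem_fiber_dP_ne_zero`); `V₂` does not move this variable.

The ideal can be taken to be all of `𝒪(𝒢)`. Each monomial is a product of a monomial without
`z_{2,1n}`, `z_{2,2n}`, killed by `V₂`, and a monomial in these two variables only, killed by `V₁`.
So the span contains all polynomials, and it remains to see that polynomials are dense in `𝒪(𝒢)`
(`mem_closure_range_polyFun`).

Density is proved by elementary means for `F = P_i - a`, which is affine in each variable and has
non-zero gradient on its zero set. Functions vanishing on the zero set are divisible by `F`
(`hasDivision_of_affine`). Two extensions of a function therefore differ by `F * H`; splitting `H`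
by Cauchy's formula on a rectangle (`cousinSplit_re`) lets them be corrected and glued
(`ExtendsNear.merge`). Sweeping through the coordinates extends the function to a neighbourhood of
any box, and Taylor expansion in one variable at a time approximates the extension by polynomials
(`exists_polynomial_approx`). -/

open GromovVaserstein

namespace GromovVaserstein

/-! ### Holomorphic dependence of integrals on parameters -/

section ParametricIntegral

variable {E F : Type*} [NormedAddCommGroup E] [NormedSpace ℂ E] [NormedAddCommGroup F]
  [NormedSpace ℂ F]

/-- A bound over the fiber at `x₀`, enlarged by one, persists near each `(x₀, s)`, and compactness
of `S` makes the neighbourhood uniform in `s`. It supplies the constant dominating functions for the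
integrals below. -/
theorem exists_eventually_norm_le_of_continuousAt {X G : Type*} [TopologicalSpace X]
    [SeminormedAddCommGroup G] {Φ : X → ℝ → G} {x₀ : X} {S : Set ℝ} (hS : IsCompact S)
    (hc : ∀ s ∈ S, ContinuousAt (Function.uncurry Φ) (x₀, s)) :
    ∃ C : ℝ, ∀ᶠ x in 𝓝 x₀, ∀ s ∈ S, ‖Φ x s‖ ≤ C := by
  have h0 : ContinuousOn (Φ x₀) S := fun s hs =>
    ((hc s hs).comp (f := fun s => (x₀, s)) (by fun_prop)).continuousWithinAt
  obtain ⟨C, hC⟩ := hS.exists_bound_of_continuousOn h0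
  refine ⟨C + 1, hS.eventually_forall_of_forall_eventually fun s hs => ?_⟩
  have := (hc s hs).norm.eventually (Iio_mem_nhds
    (show ‖Function.uncurry Φ (x₀, s)‖ < C + 1 from (hC s hs).trans_lt (lt_add_one C)))
  filter_upwards [this] with z hz using le_of_lt hz

theorem aestronglyMeasurable_uIoc_of_continuousOn {G : Type*} [NormedAddCommGroup G]
    {φ : ℝ → G} {a b : ℝ}
    (h : ContinuousOn φ (Set.uIcc a b)) :
    MeasureTheory.AEStronglyMeasurable φ (MeasureTheory.volume.restrict (Set.uIoc a b)) :=
  (intervalIntegrable_iff.1 h.intervalIntegrable).aestronglyMeasurable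

theorem continuousAt_intervalIntegral {X : Type*} [TopologicalSpace X] [FirstCountableTopology X]
    {Φ : X → ℝ → F} {x₀ : X}
    {a b : ℝ} (hc : ∀ᶠ x in 𝓝 x₀, ∀ s ∈ Set.uIcc a b, ContinuousAt (Function.uncurry Φ) (x, s)) :
    ContinuousAt (fun x => ∫ s in a..b, Φ x s) x₀ := by
  have h1 : ∀ x, (∀ s ∈ Set.uIcc a b, ContinuousAt (Function.uncurry Φ) (x, s)) →
      ContinuousOn (Φ x) (Set.uIcc a b) := fun x hx s hs =>
    ((hx s hs).comp (f := fun s => (x, s)) (by fun_prop)).continuousWithinAt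
  obtain ⟨C, hC⟩ := exists_eventually_norm_le_of_continuousAt isCompact_uIcc hc.self_of_nhds
  refine intervalIntegral.continuousAt_of_dominated_interval (bound := fun _ => C) ?_ ?_
    intervalIntegrable_const ?_
  · filter_upwards [hc] with x hx using aestronglyMeasurable_uIoc_of_continuousOn (h1 x hx)
  · filter_upwards [hC] with x hx using
      Eventually.of_forall fun s hs => hx s (Set.uIoc_subset_uIcc hs)
  · exact Eventually.of_forall fun s hs => (hc.self_of_nhds s (Set.uIoc_subset_uIcc hs)).comp
      (f := fun x => (x, s)) (by fun_prop)

/-- Complex `C¹` on an open set is the working notion of holomorphy in the extension argument: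
parametric integrals then need only one continuous derivative. -/
theorem contDiffOn_one_iff_fderiv_of_isOpen {U : Set E} (hU : IsOpen U) {f : E → F} :
    ContDiffOn ℂ 1 f U ↔ DifferentiableOn ℂ f U ∧ ContinuousOn (fderiv ℂ f) U := by
  have := contDiffOn_succ_iff_fderiv_of_isOpen (𝕜 := ℂ) (n := 0) (f := f) hU
  simpa [contDiffOn_zero] using this

theorem contDiffOn_one_of_hasFDerivAt {U : Set E} (hU : IsOpen U) {f : E → F} {f' : E → E →L[ℂ] F}
    (h : ∀ x ∈ U, HasFDerivAt f (f' x) x) (hc : ContinuousOn f' U) : ContDiffOn ℂ 1 f U := by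
  rw [contDiffOn_one_iff_fderiv_of_isOpen hU]
  exact ⟨fun x hx => (h x hx).differentiableAt.differentiableWithinAt,
    hc.congr fun x hx => (h x hx).fderiv⟩

/-- An interval integral depending on a parameter is `C¹` if the integrand is. -/
theorem contDiffOn_intervalIntegral [CompleteSpace F] {U : Set E} (hU : IsOpen U) {a b : ℝ} {Φ : E → ℝ → F}
    {Φ' : E → ℝ → E →L[ℂ] F}
    (hd : ∀ x ∈ U, ∀ s ∈ Set.uIcc a b, HasFDerivAt (fun y => Φ y s) (Φ' x s) x)
    (hc : ∀ x ∈ U, ∀ s ∈ Set.uIcc a b, ContinuousAt (Function.uncurry Φ) (x, s))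
    (hc' : ∀ x ∈ U, ∀ s ∈ Set.uIcc a b, ContinuousAt (Function.uncurry Φ') (x, s)) :
    ContDiffOn ℂ 1 (fun x => ∫ s in a..b, Φ x s) U := by
  refine contDiffOn_one_of_hasFDerivAt hU (f' := fun x => ∫ s in a..b, Φ' x s) (fun x hx => ?_)
    fun x hx => (continuousAt_intervalIntegral ?_).continuousWithinAt
  · obtain ⟨C, hC⟩ := exists_eventually_norm_le_of_continuousAt isCompact_uIcc (hc' x hx)
    refine intervalIntegral.hasFDerivAt_integral_of_dominated_of_fderiv_le (bound := fun _ => C)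
      (s := {y | y ∈ U ∧ ∀ s ∈ Set.uIcc a b, ‖Φ' y s‖ ≤ C})
      (by filter_upwards [hU.mem_nhds hx, hC] with y h1 h2 using ⟨h1, h2⟩)
      ?_ ?_ ?_ ?_ intervalIntegrable_const ?_
    · filter_upwards [hU.mem_nhds hx] with y hy
      exact aestronglyMeasurable_uIoc_of_continuousOn fun s hs =>
        ((hc y hy s hs).comp (f := fun s => (y, s)) (by fun_prop)).continuousWithinAt
    · exact ContinuousOn.intervalIntegrable fun s hs =>
        ((hc x hx s hs).comp (f := fun s => (x, s)) (by fun_prop)).continuousWithinAt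
    · exact aestronglyMeasurable_uIoc_of_continuousOn fun s hs =>
        ((hc' x hx s hs).comp (f := fun s => (x, s)) (by fun_prop)).continuousWithinAt
    · exact Eventually.of_forall fun s hs y hy => hy.2 s (Set.uIoc_subset_uIcc hs)
    · exact Eventually.of_forall fun s hs y hy => hd y hy.1 s (Set.uIoc_subset_uIcc hs)
  · filter_upwards [hU.mem_nhds hx] with y hy using hc' y hy

/-- Integrating a `C¹` function `h (x, ζ)` along a path in the second variable gives a `C¹`
function. -/
theorem contDiffOn_pathIntegral [CompleteSpace F] {U : Set E} (hU : IsOpen U) {Ω : Set (E × ℂ)} (hΩ : IsOpen Ω)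
    {h : E × ℂ → F} (hh : ContDiffOn ℂ 1 h Ω) {γ c : ℝ → ℂ} (hγ : Continuous γ)
    (hc : Continuous c) {a b : ℝ} (hmem : ∀ x ∈ U, ∀ s ∈ Set.uIcc a b, (x, γ s) ∈ Ω) :
    ContDiffOn ℂ 1 (fun x => ∫ s in a..b, c s • h (x, γ s)) U := by
  have hh' := (contDiffOn_one_iff_fderiv_of_isOpen hΩ).1 hh
  refine contDiffOn_intervalIntegral hU
    (Φ' := fun x s => c s • (fderiv ℂ h (x, γ s)).comp (ContinuousLinearMap.inl ℂ E ℂ))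
    (fun x hx s hs => ?_) (fun x hx s hs => ?_) fun x hx s hs => ?_
  · have h1 : HasFDerivAt h (fderiv ℂ h (x, γ s)) (x, γ s) :=
      (hh'.1.differentiableAt (hΩ.mem_nhds (hmem x hx s hs))).hasFDerivAt
    exact (h1.comp x (hasFDerivAt_prodMk_left x (γ s))).const_smul (c s)
  · have h1 : ContinuousAt h (x, γ s) := hh.continuousOn.continuousAt (hΩ.mem_nhds (hmem x hx s hs))
    exact ContinuousAt.smul (by fun_prop)
      (ContinuousAt.comp (f := fun p : E × ℝ => (p.1, γ p.2)) (x := (x, s)) h1 (by fun_prop))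
  · have h1 : ContinuousAt (fderiv ℂ h) (x, γ s) :=
      hh'.2.continuousAt (hΩ.mem_nhds (hmem x hx s hs))
    have h2 := ContinuousAt.comp (f := fun p : E × ℝ => (p.1, γ p.2)) (x := (x, s)) h1 (by fun_prop)
    exact ContinuousAt.smul (hc.continuousAt.comp continuousAt_snd)
      (h2.clm_comp continuousAt_const)

end ParametricIntegral

/-! ### Cauchy's integral formula on a rectangle -/

section RectangleCauchy

open Complex

/-- The integral of `f` along the boundary of `[a, b] × [c, d]`. -/
noncomputable def rectIntegral (f : ℂ → ℂ) (a b c d : ℝ) : ℂ :=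
  (∫ x : ℝ in a..b, f (x + c * I)) - (∫ x : ℝ in a..b, f (x + d * I)) +
    I * (∫ y : ℝ in c..d, f (b + y * I)) - I * ∫ y : ℝ in c..d, f (a + y * I)

/-- The principal logarithm is a primitive on the bottom, top and right sides. The left side crosses
its cut, so `log (-z)` is used there; at the two left corners it differs from `log z` by `∓πi`, and
these jumps add up to `2πi`. -/
theorem rectIntegral_inv {a b c d : ℝ} (ha : a < 0) (hb : 0 < b) (hc : c < 0) (hd : 0 < d) :
    rectIntegral (fun z => z⁻¹) a b c d = 2 * Real.pi * I := by
  have hor : ∀ y : ℝ, y ≠ 0 → ∫ x : ℝ in a..b, ((x : ℂ) + y * I)⁻¹ =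
      log (b + y * I) - log (a + y * I) := by
    intro y hy
    have hm : ∀ x : ℝ, (x : ℂ) + y * I ∈ slitPlane := fun x => by
      rw [mem_slitPlane_iff]; right; simpa using hy
    refine intervalIntegral.integral_eq_sub_of_hasDerivAt
      (f := fun x : ℝ => log ((x : ℂ) + y * I)) (fun x _ => ?_) ?_
    · have h1 : HasDerivAt (fun x : ℝ => (x : ℂ) + y * I) 1 x :=
        (ofRealCLM.hasDerivAt).add_const _
      simpa using h1.clog_real (hm x)
    · refine Continuous.intervalIntegrable (Continuous.inv₀ (by fun_prop) fun x => ?_) _ _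
      exact slitPlane_ne_zero (hm x)
  have ver : ∀ u : ℂ, ∀ x : ℝ, (∀ y : ℝ, u * ((x : ℂ) + y * I) ∈ slitPlane) →
      I * ∫ y : ℝ in c..d, ((x : ℂ) + y * I)⁻¹ =
      log (u * (x + d * I)) - log (u * (x + c * I)) := by
    intro u x hm
    have hu : u ≠ 0 := by
      rintro rfl
      simpa using hm 0
    rw [← intervalIntegral.integral_const_mul]
    refine intervalIntegral.integral_eq_sub_of_hasDerivAt
      (f := fun y : ℝ => log (u * ((x : ℂ) + y * I))) (fun y _ => ?_) ?_
    · have h1 : HasDerivAt (fun y : ℝ => u * ((x : ℂ) + y * I)) (u * (1 * I)) y :=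
        (((ofRealCLM.hasDerivAt).mul_const I).const_add _).const_mul u
      have h2 := h1.clog_real (hm y)
      rwa [one_mul, mul_div_mul_left _ _ hu, div_eq_mul_inv] at h2
    · refine Continuous.intervalIntegrable
        (continuous_const.mul (Continuous.inv₀ (by fun_prop) fun y h0 => ?_)) _ _
      exact slitPlane_ne_zero (hm y) (by rw [h0, mul_zero])
  have hright := ver 1 b fun y => by
    rw [mem_slitPlane_iff]; left; simpa using hb
  have hleft := ver (-1) a fun y => by
    rw [mem_slitPlane_iff]; left; simpa using ha
  have l1 : log (-1 * ((a : ℂ) + d * I)) = log (a + d * I) - Real.pi * I := by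
    have : 0 < ((a : ℂ) + d * I).im := by simpa using hd
    rw [neg_one_mul, log, log, norm_neg, arg_neg_eq_arg_sub_pi_of_im_pos this]
    push_cast; ring
  have l2 : log (-1 * ((a : ℂ) + c * I)) = log (a + c * I) + Real.pi * I := by
    have : ((a : ℂ) + c * I).im < 0 := by simpa using hc
    rw [neg_one_mul, log, log, norm_neg, arg_neg_eq_arg_add_pi_of_im_neg this]
    push_cast; ring
  rw [rectIntegral, hor c hc.ne, hor d hd.ne', hright, hleft, l1, l2]
  ring_nf

theorem rectIntegral_sub_inv {a b c d : ℝ} {w : ℂ} (ha : a < w.re) (hb : w.re < b)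
    (hc : c < w.im) (hd : w.im < d) :
    rectIntegral (fun z => (z - w)⁻¹) a b c d = 2 * Real.pi * I := by
  rw [← rectIntegral_inv (sub_neg.2 ha) (sub_pos.2 hb) (sub_neg.2 hc) (sub_pos.2 hd)]
  have e : ∀ x y : ℝ, (x : ℂ) + y * I - w = ((x - w.re : ℝ) : ℂ) + ((y - w.im : ℝ) : ℂ) * I := by
    intro x y
    conv_lhs => rw [← re_add_im w]
    push_cast; ring
  simp only [rectIntegral, e]
  simp only [intervalIntegral.integral_comp_sub_right
      (fun x : ℝ => ((x : ℂ) + ((c - w.im : ℝ) : ℂ) * I)⁻¹) w.re,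
    intervalIntegral.integral_comp_sub_right
      (fun x : ℝ => ((x : ℂ) + ((d - w.im : ℝ) : ℂ) * I)⁻¹) w.re,
    intervalIntegral.integral_comp_sub_right
      (fun y : ℝ => (((a - w.re : ℝ) : ℂ) + (y : ℂ) * I)⁻¹) w.im,
    intervalIntegral.integral_comp_sub_right
      (fun y : ℝ => (((b - w.re : ℝ) : ℂ) + (y : ℂ) * I)⁻¹) w.im]

theorem rectIntegral_eq_zero {f : ℂ → ℂ} {a b c d : ℝ} (hab : a ≤ b) (hcd : c ≤ d)
    (hf : DifferentiableOn ℂ f (Set.Icc a b ×ℂ Set.Icc c d)) : rectIntegral f a b c d = 0 := by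
  have := integral_boundary_rect_eq_zero_of_differentiableOn f (a + c * I) (b + d * I)
    (by simpa [Set.uIcc_of_le hab, Set.uIcc_of_le hcd] using hf)
  simpa [rectIntegral] using this

/-- Cauchy's integral formula for a rectangle. -/
theorem rectIntegral_cauchy {f : ℂ → ℂ} {a b c d : ℝ} {w : ℂ} (ha : a < w.re) (hb : w.re < b)
    (hc : c < w.im) (hd : w.im < d)
    (hf : DifferentiableOn ℂ f (Set.Icc a b ×ℂ Set.Icc c d)) :
    rectIntegral (fun z => f z / (z - w)) a b c d = 2 * Real.pi * I * f w := by
  have hn : Set.Icc a b ×ℂ Set.Icc c d ∈ 𝓝 w := by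
    refine mem_of_superset ((isOpen_Ioo.reProdIm isOpen_Ioo).mem_nhds (?_ : w ∈ Set.Ioo a b ×ℂ Set.Ioo c d)) ?_
    · exact ⟨⟨ha, hb⟩, hc, hd⟩
    · exact fun z hz => ⟨Set.Ioo_subset_Icc_self hz.1, Set.Ioo_subset_Icc_self hz.2⟩
  have h0 := rectIntegral_eq_zero (ha.trans hb).le (hc.trans hd).le
    ((differentiableOn_dslope hn).2 hf)
  have h1 := rectIntegral_sub_inv ha hb hc hd
  have hab := (ha.trans hb).le
  have hcd := (hc.trans hd).le
  have hm : ∀ x y : ℝ, x ∈ Set.Icc a b → y ∈ Set.Icc c d → (x : ℂ) + y * I ∈ Set.Icc a b ×ℂ Set.Icc c d := by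
    intro x y hx hy
    exact ⟨by simpa using hx, by simpa using hy⟩
  -- On each side `f z / (z - w)` is `dslope f w z + f w / (z - w)`; the first summand is
  -- holomorphic on the whole rectangle and contributes zero in total.
  have key : ∀ φ : ℝ → ℂ, Continuous φ → ∀ s t : ℝ, (∀ x ∈ Set.uIcc s t, φ x ≠ w) →
      (∀ x ∈ Set.uIcc s t, φ x ∈ Set.Icc a b ×ℂ Set.Icc c d) →
      ∫ x in s..t, f (φ x) / (φ x - w) =
        (∫ x in s..t, dslope f w (φ x)) + f w * ∫ x in s..t, (φ x - w)⁻¹ := by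
    intro φ hφ s t hne hmem
    rw [← intervalIntegral.integral_const_mul, ← intervalIntegral.integral_add]
    · refine intervalIntegral.integral_congr fun x hx => ?_
      have := sub_ne_zero.2 (hne x hx)
      simp only [dslope_of_ne f (hne x hx), slope, vsub_eq_sub, smul_eq_mul]
      field_simp
      ring
    · exact (((differentiableOn_dslope hn).2 hf).continuousOn.comp hφ.continuousOn
        hmem).intervalIntegrable
    · exact ContinuousOn.intervalIntegrable (continuousOn_const.mul
        (ContinuousOn.inv₀ (by fun_prop) fun x hx => sub_ne_zero.2 (hne x hx)))
  have nere : ∀ x y : ℝ, x ≠ w.re → (x : ℂ) + y * I ≠ w := fun x y h e => h (by simp [← e])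
  have neim : ∀ x y : ℝ, y ≠ w.im → (x : ℂ) + y * I ≠ w := fun x y h e => h (by simp [← e])
  rw [rectIntegral] at h0 h1 ⊢
  rw [key (fun x : ℝ => x + c * I) (by fun_prop) a b (fun x _ => neim _ _ hc.ne)
      (fun x hx => hm _ _ (by rwa [Set.uIcc_of_le hab] at hx) ⟨le_rfl, hcd⟩),
    key (fun x : ℝ => x + d * I) (by fun_prop) a b (fun x _ => neim _ _ hd.ne')
      (fun x hx => hm _ _ (by rwa [Set.uIcc_of_le hab] at hx) ⟨hcd, le_rfl⟩),
    key (fun y : ℝ => b + y * I) (by fun_prop) c d (fun x _ => nere _ _ hb.ne')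
      (fun x hx => hm _ _ ⟨hab, le_rfl⟩ (by rwa [Set.uIcc_of_le hcd] at hx)),
    key (fun y : ℝ => a + y * I) (by fun_prop) c d (fun x _ => nere _ _ ha.ne)
      (fun x hx => hm _ _ ⟨le_rfl, hab⟩ (by rwa [Set.uIcc_of_le hcd] at hx))]
  linear_combination h0 + f w * h1

end RectangleCauchy

/-! ### The additive Cousin problem in one coordinate -/

section CousinSplitting

variable {ι : Type} [Fintype ι] [DecidableEq ι]

theorem contDiff_update_prod {n : WithTop ℕ∞} (j : ι) :
    ContDiff ℂ n fun p : (ι → ℂ) × ℂ => Function.update p.1 j p.2 := by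
  rw [contDiff_pi]
  intro k
  by_cases hk : k = j
  · subst hk; simpa using contDiff_snd
  · simp only [Function.update_of_ne hk]; fun_prop

/-- The weight `c` stands for the derivative of the path: it is `1` for the sides of a rectangle and
`deriv (circleMap _ _)` for circles. -/
theorem contDiffOn_cauchyKernelIntegral {W U : Set (ι → ℂ)} (hW : IsOpen W) (hU : IsOpen U) (j : ι)
    {H : (ι → ℂ) → ℂ} (hH : ContDiffOn ℂ 1 H W) {γ c : ℝ → ℂ} (hγ : Continuous γ)
    (hc : Continuous c) {a b : ℝ}
    (hmem : ∀ z ∈ U, ∀ s ∈ Set.uIcc a b, Function.update z j (γ s) ∈ W ∧ γ s ≠ z j) :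
    ContDiffOn ℂ 1 (fun z => ∫ s in a..b, c s * (H (Function.update z j (γ s)) / (γ s - z j))) U := by
  have hcu := contDiff_update_prod (ι := ι) (n := 1) j
  refine contDiffOn_pathIntegral hU (Ω := {p | Function.update p.1 j p.2 ∈ W ∧ p.2 ≠ p.1 j})
    (h := fun p => H (Function.update p.1 j p.2) / (p.2 - p.1 j)) ?_ ?_ hγ hc hmem
  · exact (hW.preimage hcu.continuous).inter
      (isOpen_ne_fun continuous_snd ((continuous_apply j).comp continuous_fst))
  · refine ContDiffOn.div (hH.comp hcu.contDiffOn fun p hp => hp.1) ?_ fun p hp => sub_ne_zero.2 hp.2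
    fun_prop

/-- `T` separates `K₁` and `K₂` in such a way that the additive Cousin problem can be solved: in each
coordinate of a product of compact sets, a holomorphic function near `T` is a difference of
holomorphic functions near `K₁` and near `K₂`. -/
def CousinSplit (T K₁ K₂ : Set ℂ) : Prop :=
  ∀ (ι : Type) [Fintype ι] [DecidableEq ι] (C : ι → Set ℂ), (∀ k, IsCompact (C k)) → ∀ (j : ι)
    (W : Set (ι → ℂ)) (H : (ι → ℂ) → ℂ), IsOpen W → Set.univ.pi (Function.update C j T) ⊆ W →
    ContDiffOn ℂ 1 H W →
    ∃ U₁ U₂ : Set (ι → ℂ), IsOpen U₁ ∧ IsOpen U₂ ∧ Set.univ.pi (Function.update C j K₁) ⊆ U₁ ∧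
      Set.univ.pi (Function.update C j K₂) ⊆ U₂ ∧ U₁ ∩ U₂ ⊆ W ∧
      ∃ H₁ H₂ : (ι → ℂ) → ℂ, ContDiffOn ℂ 1 H₁ U₁ ∧ ContDiffOn ℂ 1 H₂ U₂ ∧
        ∀ z ∈ U₁ ∩ U₂, H z = H₁ z - H₂ z

theorem mem_thickening_pi {κ : Type} [Fintype κ] {D : κ → Set ℂ} {δ : ℝ} {z : κ → ℂ} (hδ : 0 < δ)
    (hz : ∀ k, z k ∈ Metric.thickening δ (D k)) : z ∈ Metric.thickening δ (Set.univ.pi D) := by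
  simp only [Metric.mem_thickening_iff] at hz ⊢
  choose w hw hd using hz
  exact ⟨w, fun k _ => hw k, (dist_pi_lt_iff hδ).2 hd⟩

theorem mem_thickening_segment {t c d δ : ℝ} (hcd : c ≤ d) (hδ : 0 < δ) {z : ℂ}
    (h1 : |z.re - t| ≤ δ / 3) (h2 : c - δ / 3 ≤ z.im) (h3 : z.im ≤ d + δ / 3) :
    z ∈ Metric.thickening δ ({t} ×ℂ Set.Icc c d) := by
  rw [Metric.mem_thickening_iff]
  -- The witness is the nearest point of the segment; its real and imaginary distances are at most
  -- `δ / 3` each.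
  refine ⟨⟨t, max c (min d z.im)⟩, ⟨rfl, le_max_left _ _, max_le hcd (min_le_left _ _)⟩, ?_⟩
  rw [dist_eq_norm]
  refine (Complex.norm_le_abs_re_add_abs_im _).trans_lt ?_
  have : |z.im - max c (min d z.im)| ≤ δ / 3 := by
    rw [abs_le]
    constructor
    · rcases max_cases c (min d z.im) with ⟨h, -⟩ | ⟨h, -⟩ <;> rw [h]
      · linarith
      · linarith [min_le_right d z.im]
    · have h4 := le_max_right c (min d z.im)
      rcases min_cases d z.im with ⟨h, -⟩ | ⟨h, -⟩ <;> rw [h] at h4 <;> rw [h] <;> linarith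
  simp only [Complex.sub_re, Complex.sub_im]
  linarith

theorem pi_update_mem {κ : Type} [DecidableEq κ] {C : κ → Set ℂ} {j : κ} {K : Set ℂ} {z : κ → ℂ} :
    z ∈ Set.univ.pi (Function.update C j K) ↔ z j ∈ K ∧ ∀ k, k ≠ j → z k ∈ C k := by
  constructor
  · intro h
    refine ⟨by simpa using h j trivial, fun k hk => by simpa [hk] using h k trivial⟩
  · rintro ⟨h1, h2⟩ k -
    by_cases hk : k = j
    · subst hk; simpa using h1
    · simpa [hk] using h2 k hk

theorem isCompact_update {κ : Type} [DecidableEq κ] {C : κ → Set ℂ} (hC : ∀ k, IsCompact (C k))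
    (j : κ) {K : Set ℂ} (hK : IsCompact K) (k : κ) : IsCompact (Function.update C j K k) := by
  by_cases hk : k = j
  · subst hk; simpa using hK
  · simpa [hk] using hC k

/-- Cauchy's formula in `z_j` over `[t - e, t + e] × [c - e, d + e]` writes `H` as a sum over four
sides. The left side gives a function holomorphic to its right, which is `-H₂`; the other three give
`H₁`, holomorphic to the left of the right side. Both live inside the horizontal band, which is why
the top and bottom sides may go to either one. -/
theorem cousinSplit_re {t c d : ℝ} (hcd : c ≤ d) :
    CousinSplit ({t} ×ℂ Set.Icc c d) (Set.Iic t ×ℂ Set.Icc c d) (Set.Ici t ×ℂ Set.Icc c d) := by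
  intro ι _ _ C hC j W H hW hTW hH
  have hcomp : IsCompact (Set.univ.pi (Function.update C j ({t} ×ℂ Set.Icc c d))) :=
    isCompact_univ_pi (isCompact_update hC j (isCompact_singleton.reProdIm isCompact_Icc))
  obtain ⟨δ, hδ, hδW⟩ := hcomp.exists_thickening_subset_open hW hTW
  set e := δ / 3 with he
  have he0 : 0 < e := by positivity
  -- `N` leaves the coordinate `j` free, so that `z j` can run over the contour while the other
  -- coordinates stay near their compact sets.
  let N : Set (ι → ℂ) := {z | ∀ k, k ≠ j → z k ∈ Metric.thickening δ (C k)}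
  have hN : IsOpen N := by
    simp only [N, Set.ofPred_forall]
    exact isOpen_iInter_of_finite fun k => isOpen_iInter_of_finite fun _ =>
      Metric.isOpen_thickening.preimage (continuous_apply k)
  have hNW : ∀ z ∈ N, ∀ ζ : ℂ, |ζ.re - t| ≤ e → c - e ≤ ζ.im → ζ.im ≤ d + e →
      Function.update z j ζ ∈ W := by
    intro z hz ζ h1 h2 h3
    refine hδW (mem_thickening_pi hδ fun k => ?_)
    by_cases hk : k = j
    · subst hk
      simpa using mem_thickening_segment hcd hδ h1 h2 h3
    · simpa [hk] using hz k hk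
  have hre : Continuous fun z : ι → ℂ => (z j).re := Complex.continuous_re.comp (continuous_apply j)
  have him : Continuous fun z : ι → ℂ => (z j).im := Complex.continuous_im.comp (continuous_apply j)
  have hband : IsOpen {z : ι → ℂ | c - e < (z j).im ∧ (z j).im < d + e} :=
    (isOpen_lt continuous_const him).inter (isOpen_lt him continuous_const)
  let U₁ : Set (ι → ℂ) := {z | z ∈ N ∧ (z j).re < t + e ∧ c - e < (z j).im ∧ (z j).im < d + e}
  let U₂ : Set (ι → ℂ) := {z | z ∈ N ∧ t - e < (z j).re ∧ c - e < (z j).im ∧ (z j).im < d + e}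
  have hU₁ : IsOpen U₁ := hN.inter ((isOpen_lt hre continuous_const).inter hband)
  have hU₂ : IsOpen U₂ := hN.inter ((isOpen_lt continuous_const hre).inter hband)
  have hNC : ∀ z : ι → ℂ, (∀ k, k ≠ j → z k ∈ C k) → z ∈ N := fun z hz k hk =>
    Metric.self_subset_thickening hδ _ (hz k hk)
  let k : (ι → ℂ) → ℂ → ℂ := fun z ζ => H (Function.update z j ζ) / (ζ - z j)
  have hle : t - e ≤ t + e := by linarith
  have hle' : c - e ≤ d + e := by linarith
  refine ⟨U₁, U₂, hU₁, hU₂, ?_, ?_, ?_,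
    fun z => (2 * Real.pi * Complex.I)⁻¹ *
      ((∫ x : ℝ in (t - e)..(t + e), k z (x + (c - e : ℝ) * Complex.I)) -
        (∫ x : ℝ in (t - e)..(t + e), k z (x + (d + e : ℝ) * Complex.I)) +
        Complex.I * ∫ y : ℝ in (c - e)..(d + e), k z ((t + e : ℝ) + y * Complex.I)),
    fun z => (2 * Real.pi * Complex.I)⁻¹ *
      (Complex.I * ∫ y : ℝ in (c - e)..(d + e), k z ((t - e : ℝ) + y * Complex.I)), ?_, ?_, ?_⟩
  · intro z hz
    obtain ⟨⟨h1, h2, h3⟩, h4⟩ := pi_update_mem.1 hz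
    simp only [Set.mem_preimage, Set.mem_Iic] at h1 h2 h3
    exact ⟨hNC z h4, by linarith, by linarith, by linarith⟩
  · intro z hz
    obtain ⟨⟨h1, h2, h3⟩, h4⟩ := pi_update_mem.1 hz
    simp only [Set.mem_preimage, Set.mem_Ici] at h1 h2 h3
    exact ⟨hNC z h4, by linarith, by linarith, by linarith⟩
  · rintro z ⟨⟨h1, h2, h3, h4⟩, -, h5, -, -⟩
    have := hNW z h1 (z j) (abs_le.2 ⟨by linarith, by linarith⟩) h3.le h4.le
    rwa [Function.update_eq_self] at this
  · have hor : ∀ y : ℝ, c - e ≤ y → y ≤ d + e → (∀ z ∈ U₁, (z j).im ≠ y) →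
        ContDiffOn ℂ 1 (fun z => ∫ x : ℝ in (t - e)..(t + e), k z (x + y * Complex.I)) U₁ := by
      intro y h1 h2 h3
      have := contDiffOn_cauchyKernelIntegral hW hU₁ j hH (γ := fun x : ℝ => x + y * Complex.I)
        (c := fun _ => 1) (by fun_prop) continuous_const (a := t - e) (b := t + e) fun z hz s hs => by
          rw [Set.uIcc_of_le hle] at hs
          refine ⟨hNW z hz.1 _ ?_ ?_ ?_, fun h => h3 z hz (by simp [← h])⟩
          · rw [abs_le]; simpa [add_comm e] using hs
          · simpa using h1
          · simpa using h2
      simpa only [one_mul] using this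
    refine contDiffOn_const.mul (((hor _ le_rfl hle' fun z hz => hz.2.2.1.ne').sub
      (hor _ hle' le_rfl fun z hz => hz.2.2.2.ne)).add (contDiffOn_const.mul ?_))
    have := contDiffOn_cauchyKernelIntegral hW hU₁ j hH
      (γ := fun y : ℝ => (t + e : ℝ) + y * Complex.I)
      (c := fun _ => 1) (by fun_prop) continuous_const (a := c - e) (b := d + e) fun z hz s hs => by
        rw [Set.uIcc_of_le hle'] at hs
        refine ⟨hNW z hz.1 _ ?_ ?_ ?_, fun h => hz.2.1.ne (by simp [← h])⟩
        · simp [abs_of_pos he0]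
        · simpa using hs.1
        · simpa using hs.2
    simpa only [one_mul] using this
  · refine contDiffOn_const.mul (contDiffOn_const.mul ?_)
    have := contDiffOn_cauchyKernelIntegral hW hU₂ j hH
      (γ := fun y : ℝ => (t - e : ℝ) + y * Complex.I)
      (c := fun _ => 1) (by fun_prop) continuous_const (a := c - e) (b := d + e) fun z hz s hs => by
        rw [Set.uIcc_of_le hle'] at hs
        refine ⟨hNW z hz.1 _ ?_ ?_ ?_, fun h => hz.2.1.ne' (by simp [← h])⟩
        · simp [abs_of_pos he0]
        · simpa using hs.1
        · simpa using hs.2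
    simpa only [one_mul] using this
  · rintro z ⟨⟨h1, h2, h3, h4⟩, -, h5, -, -⟩
    have hd : DifferentiableOn ℂ (fun ζ => H (Function.update z j ζ))
        (Set.Icc (t - e) (t + e) ×ℂ Set.Icc (c - e) (d + e)) := by
      intro ζ hζ
      obtain ⟨⟨a1, a2⟩, a3, a4⟩ := hζ
      have hm := hNW z h1 ζ (abs_le.2 ⟨by linarith, by linarith⟩) a3 a4
      have h6 := (hH.contDiffAt (hW.mem_nhds hm)).differentiableAt one_ne_zero
      have h7 : DifferentiableAt ℂ (fun ζ => Function.update z j ζ) ζ :=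
        (hasFDerivAt_update z ζ).differentiableAt
      exact (h6.comp ζ h7).differentiableWithinAt
    have := rectIntegral_cauchy h5 h2 h3 h4 hd
    rw [Function.update_eq_self, rectIntegral] at this
    have hpi : (2 * Real.pi * Complex.I : ℂ) ≠ 0 := Complex.two_pi_I_ne_zero
    rw [← mul_sub, eq_inv_mul_iff_mul_eq₀ hpi]
    exact this.symm

/-- The splitting problem is invariant under the linear change of variable `z_j ↦ u z_j`. A quarter
turn makes horizontal cuts out of vertical ones. -/
theorem CousinSplit.preimage_mul {T K₁ K₂ : Set ℂ} (h : CousinSplit T K₁ K₂) {u : ℂ} (hu : u ≠ 0) :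
    CousinSplit ((u * ·) ⁻¹' T) ((u * ·) ⁻¹' K₁) ((u * ·) ⁻¹' K₂) := by
  intro ι _ _ C hC j W H hW hTW hH
  let m : ℂ → (ι → ℂ) → ι → ℂ := fun v z => Function.update z j (v * z j)
  have hm : ∀ v, ContDiff ℂ 1 (m v) := fun v =>
    (contDiff_update_prod j).comp (contDiff_id.prodMk (contDiff_const.mul (contDiff_apply ℂ ℂ j)))
  have hinv : ∀ z, m u⁻¹ (m u z) = z := fun z => by simp [m, hu]
  have hmap : ∀ K : Set ℂ, ∀ z ∈ Set.univ.pi (Function.update C j ((u * ·) ⁻¹' K)),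
      m u z ∈ Set.univ.pi (Function.update C j K) := by
    intro K z hz
    obtain ⟨h1, h2⟩ := pi_update_mem.1 hz
    exact pi_update_mem.2 ⟨by simpa [m] using h1, fun k hk => by simpa [m, hk] using h2 k hk⟩
  obtain ⟨U₁, U₂, hU₁, hU₂, hK₁, hK₂, hUW, H₁, H₂, hH₁, hH₂, heq⟩ :=
    h ι C hC j (m u⁻¹ ⁻¹' W) (H ∘ m u⁻¹) (hW.preimage (hm _).continuous) (fun z hz => hTW (by
      obtain ⟨h1, h2⟩ := pi_update_mem.1 hz
      exact pi_update_mem.2 ⟨by simpa [m, hu] using h1, fun k hk => by simpa [m, hk] using h2 k hk⟩))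
      (hH.comp (hm _).contDiffOn fun z hz => hz)
  refine ⟨m u ⁻¹' U₁, m u ⁻¹' U₂, hU₁.preimage (hm _).continuous, hU₂.preimage (hm _).continuous,
    fun z hz => hK₁ (hmap _ z hz), fun z hz => hK₂ (hmap _ z hz), fun z hz => ?_, H₁ ∘ m u,
    H₂ ∘ m u, hH₁.comp (hm _).contDiffOn fun z hz => hz, hH₂.comp (hm _).contDiffOn fun z hz => hz,
    fun z hz => ?_⟩
  · have := hUW (show m u z ∈ U₁ ∩ U₂ from hz)
    rwa [Set.mem_preimage, hinv] at this
  · have := heq (m u z) hz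
    simpa [Function.comp, hinv] using this

theorem cousinSplit_im {t c d : ℝ} (hcd : c ≤ d) :
    CousinSplit (Set.Icc c d ×ℂ {t}) (Set.Icc c d ×ℂ Set.Iic t) (Set.Icc c d ×ℂ Set.Ici t) := by
  have key : ∀ S : Set ℝ, ((-Complex.I) * ·) ⁻¹' (S ×ℂ Set.Icc (-d) (-c)) = Set.Icc c d ×ℂ S := by
    intro S
    ext z
    simp [Complex.mem_reProdIm, and_comm]
  have := (cousinSplit_re (t := t) (neg_le_neg hcd)).preimage_mul (neg_ne_zero.2 Complex.I_ne_zero)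
  rwa [key, key, key] at this

end CousinSplitting

/-! ### Extending functions from a hypersurface to boxes -/

section Extension

variable {ι : Type} [Fintype ι]

/-- Near `S`, the function `f` on the zero set of `F` is the restriction of a holomorphic function. -/
def ExtendsNear (F f : (ι → ℂ) → ℂ) (S : Set (ι → ℂ)) : Prop :=
  ∃ U, IsOpen U ∧ S ⊆ U ∧ ∃ G, ContDiffOn ℂ 1 G U ∧ ∀ z ∈ U, F z = 0 → G z = f z

/-- Holomorphic functions that vanish on the zero set of `F` are divisible by `F`. -/
def HasDivision (F : (ι → ℂ) → ℂ) : Prop :=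
  ∀ (W : Set (ι → ℂ)) (D : (ι → ℂ) → ℂ), IsOpen W → ContDiffOn ℂ 1 D W →
    (∀ z ∈ W, F z = 0 → D z = 0) → ∃ H, ContDiffOn ℂ 1 H W ∧ ∀ z ∈ W, F z * H z = D z

theorem ExtendsNear.mono {F f : (ι → ℂ) → ℂ} {S S' : Set (ι → ℂ)} (h : ExtendsNear F f S')
    (hS : S ⊆ S') : ExtendsNear F f S := by
  obtain ⟨U, hU, hSU, h⟩ := h
  exact ⟨U, hU, hS.trans hSU, h⟩

variable [DecidableEq ι]

/-- The difference `G₁ - G₂` vanishes on the hypersurface, hence equals `F * H`. With `H = H₁ - H₂`,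
the functions `G₁ - F * H₁` and `G₂ - F * H₂` agree on the overlap, and the corrections do not
affect values where `F = 0`. -/
theorem ExtendsNear.merge {F f : (ι → ℂ) → ℂ} (hF : ContDiff ℂ 1 F) (hdiv : HasDivision F)
    {C : ι → Set ℂ} (hC : ∀ k, IsCompact (C k)) {j : ι} {T K₁ K₂ L₁ L₂ : Set ℂ}
    (hs : CousinSplit T K₁ K₂) (hT₁ : T ⊆ L₁) (hT₂ : T ⊆ L₂) (hL₁ : L₁ ⊆ K₁) (hL₂ : L₂ ⊆ K₂)
    (h₁ : ExtendsNear F f (Set.univ.pi (Function.update C j L₁)))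
    (h₂ : ExtendsNear F f (Set.univ.pi (Function.update C j L₂))) :
    ExtendsNear F f (Set.univ.pi (Function.update C j (L₁ ∪ L₂))) := by
  obtain ⟨V₁, hV₁, hLV₁, G₁, hG₁, hGf₁⟩ := h₁
  obtain ⟨V₂, hV₂, hLV₂, G₂, hG₂, hGf₂⟩ := h₂
  have hmono : ∀ {K K' : Set ℂ}, K ⊆ K' → Set.univ.pi (Function.update C j K) ⊆
      Set.univ.pi (Function.update C j K') := fun h z hz =>
    pi_update_mem.2 ⟨h (pi_update_mem.1 hz).1, (pi_update_mem.1 hz).2⟩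
  obtain ⟨H, hH, hFH⟩ := hdiv (V₁ ∩ V₂) (fun z => G₁ z - G₂ z) (hV₁.inter hV₂)
    ((hG₁.mono Set.inter_subset_left).sub (hG₂.mono Set.inter_subset_right)) fun z hz h0 => by
      rw [hGf₁ z hz.1 h0, hGf₂ z hz.2 h0, sub_self]
  obtain ⟨U₁, U₂, hU₁, hU₂, hK₁, hK₂, hUW, H₁, H₂, hH₁, hH₂, heq⟩ := hs ι C hC j (V₁ ∩ V₂) H
    (hV₁.inter hV₂) (fun z hz => ⟨hLV₁ (hmono hT₁ hz), hLV₂ (hmono hT₂ hz)⟩) hH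
  classical
  let E₁ : (ι → ℂ) → ℂ := fun z => G₁ z - F z * H₁ z
  let E₂ : (ι → ℂ) → ℂ := fun z => G₂ z - F z * H₂ z
  have hE₁ : ContDiffOn ℂ 1 E₁ (V₁ ∩ U₁) := (hG₁.mono Set.inter_subset_left).sub
    (hF.contDiffOn.mul (hH₁.mono Set.inter_subset_right))
  have hE₂ : ContDiffOn ℂ 1 E₂ (V₂ ∩ U₂) := (hG₂.mono Set.inter_subset_left).sub
    (hF.contDiffOn.mul (hH₂.mono Set.inter_subset_right))
  have hE : ∀ z ∈ V₁ ∩ U₁, z ∈ V₂ ∩ U₂ → E₁ z = E₂ z := by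
    intro z hz hz'
    have e1 := hFH z ⟨hz.1, hz'.1⟩
    rw [heq z ⟨hz.2, hz'.2⟩] at e1
    simp only [E₁, E₂]
    linear_combination -e1
  let E : (ι → ℂ) → ℂ := fun z => if z ∈ V₁ ∩ U₁ then E₁ z else E₂ z
  have hEe₁ : ∀ z ∈ V₁ ∩ U₁, E z = E₁ z := fun z hz => if_pos hz
  have hEe₂ : ∀ z ∈ V₂ ∩ U₂, E z = E₂ z := fun z hz => by
    by_cases h : z ∈ V₁ ∩ U₁
    · rw [hEe₁ z h, hE z h hz]
    · exact if_neg h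
  have ho₁ := hV₁.inter hU₁
  have ho₂ := hV₂.inter hU₂
  refine ⟨V₁ ∩ U₁ ∪ V₂ ∩ U₂, ho₁.union ho₂, fun z hz => ?_, E, ?_, ?_⟩
  · obtain ⟨hj | hj, hk⟩ := pi_update_mem.1 hz
    · have := pi_update_mem.2 ⟨hj, hk⟩
      exact Or.inl ⟨hLV₁ this, hK₁ (hmono hL₁ this)⟩
    · have := pi_update_mem.2 ⟨hj, hk⟩
      exact Or.inr ⟨hLV₂ this, hK₂ (hmono hL₂ this)⟩
  · exact (hE₁.congr hEe₁).union_of_isOpen (hE₂.congr hEe₂) ho₁ ho₂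
  · rintro z (hz | hz) h0
    · rw [hEe₁ z hz]; simp [E₁, h0, hGf₁ z hz.1 h0]
    · rw [hEe₂ z hz]; simp [E₂, h0, hGf₂ z hz.1 h0]

/-- A property of closed intervals that holds for all short intervals near a point and is
inherited by the union of adjacent intervals holds for all intervals. -/
theorem interval_induction {p : ℝ → ℝ → Prop} {a b : ℝ} (hab : a ≤ b)
    (hloc : ∀ t ∈ Set.Icc a b, ∃ δ > 0, ∀ x y, t - δ < x → x ≤ y → y < t + δ → p x y)
    (hmerge : ∀ x y z, x ≤ y → y ≤ z → p x y → p y z → p x z) : p a b := by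
  choose! δ hδ hp using hloc
  obtain ⟨t, h0, hmono, ⟨m, hm⟩, hsub⟩ := exists_monotone_Icc_subset_open_cover_Icc hab
    (c := fun s : Set.Icc a b => {x : Set.Icc a b | (s : ℝ) - δ s < x ∧ (x : ℝ) < s + δ s})
    (fun s => (isOpen_lt continuous_const continuous_subtype_val).inter
      (isOpen_lt continuous_subtype_val continuous_const))
    (fun s _ => Set.mem_iUnion.2 ⟨s, by
      have := hδ s s.2
      exact ⟨by linarith, by linarith⟩⟩)
  have step : ∀ k, p (t k) (t (k + 1)) := fun k => by
    obtain ⟨s, hs⟩ := hsub k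
    have hk := hmono (Nat.le_succ k)
    exact hp s s.2 _ _ (hs ⟨le_rfl, hk⟩).1 hk (hs ⟨hk, le_rfl⟩).2
  have all : ∀ k, p (t 0) (t (k + 1)) := by
    intro k
    induction k with
    | zero => exact step 0
    | succ k ih => exact hmerge _ _ _ (hmono (Nat.zero_le _)) (hmono (Nat.le_succ _)) ih (step _)
  have := all m
  rwa [h0, hm (m + 1) (Nat.le_succ m)] at this

/-- A neighbourhood of a product of compact sets contains a product neighbourhood. This gives the
local hypothesis of `interval_induction`. -/
theorem ExtendsNear.exists_thickening {F f : (ι → ℂ) → ℂ} {C : ι → Set ℂ}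
    (hC : ∀ k, IsCompact (C k)) {j : ι} {K : Set ℂ} (hK : IsCompact K)
    (h : ExtendsNear F f (Set.univ.pi (Function.update C j K))) :
    ∃ δ > 0, ExtendsNear F f (Set.univ.pi (Function.update C j (Metric.thickening δ K))) := by
  obtain ⟨U, hU, hSU, h⟩ := h
  obtain ⟨δ, hδ, hδU⟩ := (isCompact_univ_pi (isCompact_update hC j hK)).exists_thickening_subset_open
    hU hSU
  refine ⟨δ, hδ, U, hU, fun z hz => hδU (mem_thickening_pi hδ fun k => ?_), h⟩
  obtain ⟨h1, h2⟩ := pi_update_mem.1 hz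
  by_cases hk : k = j
  · subst hk; simpa using h1
  · simpa [hk] using Metric.self_subset_thickening hδ _ (h2 k hk)

theorem ExtendsNear.of_thickening {F f : (ι → ℂ) → ℂ} {C : ι → Set ℂ} {j : ι} {K L : Set ℂ}
    (h : ExtendsNear F f (Set.univ.pi (Function.update C j L))) (hKL : K ⊆ L) :
    ExtendsNear F f (Set.univ.pi (Function.update C j K)) :=
  h.mono fun _ hz => pi_update_mem.2 ⟨hKL (pi_update_mem.1 hz).1, (pi_update_mem.1 hz).2⟩

/-- Two sweeps: points are merged into vertical segments across cuts that are single points, then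
segments are merged into a rectangle across vertical cuts. -/
theorem ExtendsNear.rect {F f : (ι → ℂ) → ℂ} (hF : ContDiff ℂ 1 F) (hdiv : HasDivision F)
    {C : ι → Set ℂ} (hC : ∀ k, IsCompact (C k)) {j : ι} {a b c d : ℝ} (hab : a ≤ b) (hcd : c ≤ d)
    (h : ∀ w, ExtendsNear F f (Set.univ.pi (Function.update C j {w}))) :
    ExtendsNear F f (Set.univ.pi (Function.update C j (Set.Icc a b ×ℂ Set.Icc c d))) := by
  have vert : ∀ t : ℝ, ExtendsNear F f (Set.univ.pi (Function.update C j ({t} ×ℂ Set.Icc c d))) := by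
    intro t
    refine interval_induction (p := fun x y =>
      ExtendsNear F f (Set.univ.pi (Function.update C j ({t} ×ℂ Set.Icc x y)))) hcd
      (fun s _ => ?_) fun x y z hxy hyz h1 h2 => ?_
    · obtain ⟨δ, hδ, hE⟩ := (h ⟨t, s⟩).exists_thickening hC isCompact_singleton
      refine ⟨δ, hδ, fun x y hx hxy hy => hE.of_thickening fun z hz => ?_⟩
      obtain ⟨e1, e2, e3⟩ := hz
      simp only [Set.mem_preimage, Set.mem_singleton_iff] at e1 e2 e3
      rw [Metric.thickening_singleton, Metric.mem_ball, dist_eq_norm]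
      have : z - ⟨t, s⟩ = ((z.im - s : ℝ) : ℂ) * Complex.I := by
        apply Complex.ext <;> simp [e1]
      rw [this, norm_mul, Complex.norm_I, mul_one, Complex.norm_real, Real.norm_eq_abs, abs_lt]
      exact ⟨by linarith, by linarith⟩
    · have := ExtendsNear.merge hF hdiv hC (cousinSplit_im (t := y) (le_refl t)) (j := j)
        (L₁ := {t} ×ℂ Set.Icc x y) (L₂ := {t} ×ℂ Set.Icc y z) ?_ ?_ ?_ ?_ h1 h2
      · refine this.of_thickening fun w hw => ?_
        obtain ⟨e1, e2, e3⟩ := hw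
        rcases le_total w.im y with h | h
        · exact Or.inl ⟨e1, e2, h⟩
        · exact Or.inr ⟨e1, h, e3⟩
      · rintro w ⟨e1, e2⟩
        simp only [Set.mem_preimage, Set.mem_singleton_iff, Set.Icc_self] at e1 e2
        exact ⟨e1, by simp [e2, hxy]⟩
      · rintro w ⟨e1, e2⟩
        simp only [Set.mem_preimage, Set.mem_singleton_iff, Set.Icc_self] at e1 e2
        exact ⟨e1, by simp [e2, hyz]⟩
      · rintro w ⟨e1, e2⟩
        exact ⟨by simpa using e1, e2.2⟩
      · rintro w ⟨e1, e2⟩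
        exact ⟨by simpa using e1, e2.1⟩
  refine interval_induction (p := fun x y =>
    ExtendsNear F f (Set.univ.pi (Function.update C j (Set.Icc x y ×ℂ Set.Icc c d)))) hab
    (fun s _ => ?_) fun x y z hxy hyz h1 h2 => ?_
  · obtain ⟨δ, hδ, hE⟩ := (vert s).exists_thickening hC (isCompact_singleton.reProdIm isCompact_Icc)
    refine ⟨δ, hδ, fun x y hx hxy hy => hE.of_thickening fun z hz => ?_⟩
    obtain ⟨⟨e1, e2⟩, e3⟩ := hz
    rw [Metric.mem_thickening_iff]
    refine ⟨⟨s, z.im⟩, ⟨rfl, e3⟩, ?_⟩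
    have : z - ⟨s, z.im⟩ = ((z.re - s : ℝ) : ℂ) := by
      apply Complex.ext <;> simp
    rw [dist_eq_norm, this, Complex.norm_real, Real.norm_eq_abs, abs_lt]
    exact ⟨by linarith, by linarith⟩
  · have := ExtendsNear.merge hF hdiv hC (cousinSplit_re (t := y) hcd) (j := j)
      (L₁ := Set.Icc x y ×ℂ Set.Icc c d) (L₂ := Set.Icc y z ×ℂ Set.Icc c d) ?_ ?_ ?_ ?_ h1 h2
    · refine this.of_thickening fun w hw => ?_
      obtain ⟨⟨e1, e2⟩, e3⟩ := hw
      rcases le_total w.re y with h | h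
      · exact Or.inl ⟨⟨e1, h⟩, e3⟩
      · exact Or.inr ⟨⟨h, e2⟩, e3⟩
    · rintro w ⟨e1, e2⟩
      simp only [Set.mem_preimage, Set.mem_singleton_iff] at e1
      exact ⟨by simp [e1, hxy], e2⟩
    · rintro w ⟨e1, e2⟩
      simp only [Set.mem_preimage, Set.mem_singleton_iff] at e1
      exact ⟨by simp [e1, hyz], e2⟩
    · exact fun w hw => ⟨hw.1.2, hw.2⟩
    · exact fun w hw => ⟨hw.1.1, hw.2⟩

/-- A function on a hypersurface that extends locally extends to a neighbourhood of each box. -/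
theorem ExtendsNear.box {F f : (ι → ℂ) → ℂ} (hF : ContDiff ℂ 1 F) (hdiv : HasDivision F)
    (hloc : ∀ p, ExtendsNear F f {p}) {a b c d : ℝ} (hab : a ≤ b) (hcd : c ≤ d) :
    ExtendsNear F f (Set.univ.pi fun _ => Set.Icc a b ×ℂ Set.Icc c d) := by
  -- The coordinates in `s` already range over the full rectangle, the others are frozen at `p`.
  -- Quantifying over `p` lets the next coordinate be frozen at every `w`, as `ExtendsNear.rect`
  -- demands.
  have main : ∀ (s : Finset ι) (p : ι → ℂ), ExtendsNear F f
      (Set.univ.pi fun k => if k ∈ s then Set.Icc a b ×ℂ Set.Icc c d else {p k}) := by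
    intro s
    induction s using Finset.induction_on with
    | empty =>
      intro p
      refine (hloc p).mono fun z hz => ?_
      rw [Set.mem_singleton_iff]
      funext k
      simpa using hz k trivial
    | insert j s hj ih =>
      intro p
      have := ExtendsNear.rect hF hdiv (j := j) (f := f)
        (C := fun k => if k ∈ s then Set.Icc a b ×ℂ Set.Icc c d else {p k}) (fun k => by
          by_cases hk : k ∈ s
          · simpa [hk] using isCompact_Icc.reProdIm isCompact_Icc
          · simp [hk]) hab hcd (fun w => (ih (Function.update p j w)).mono fun z hz k _ => by
            obtain ⟨h1, h2⟩ := pi_update_mem.1 hz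
            by_cases hk : k = j
            · subst hk; simpa [hj] using h1
            · simpa [hk] using h2 k hk)
      refine this.mono fun z hz => pi_update_mem.2 ⟨by simpa using hz j trivial, fun k hk => ?_⟩
      simpa [hk] using hz k trivial
  simpa using main Finset.univ 0

end Extension

/-! ### Division by the equation of the hypersurface -/

section Division

variable {ι : Type} [Fintype ι] [DecidableEq ι]

theorem contDiffOn_circleIntegral_kernel {W U : Set (ι → ℂ)} (hW : IsOpen W) (hU : IsOpen U) (j : ι)
    {H : (ι → ℂ) → ℂ} (hH : ContDiffOn ℂ 1 H W) {c : ℂ} {r : ℝ} (hr : 0 ≤ r)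
    (hmem : ∀ z ∈ U, ∀ ζ ∈ Metric.sphere c r, Function.update z j ζ ∈ W ∧ ζ ≠ z j) :
    ContDiffOn ℂ 1 (fun z => ∮ ζ in C(c, r), (ζ - z j)⁻¹ • H (Function.update z j ζ)) U := by
  have := contDiffOn_cauchyKernelIntegral hW hU j hH (γ := circleMap c r)
    (c := fun θ => deriv (circleMap c r) θ) (a := 0) (b := 2 * Real.pi) (continuous_circleMap c r)
    (by simp only [deriv_circleMap]; fun_prop) fun z hz θ _ =>
      hmem z hz _ (circleMap_mem_sphere c hr θ)
  simpa only [circleIntegral, smul_eq_mul, div_eq_inv_mul] using this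

/-- In the variable `ζ = z_q` one has `F = A z * (ζ - φ z)`, and `D` vanishes at the root `φ z`, so
`D / F` has a removable singularity. Its Cauchy integral over a circle that avoids the root is
holomorphic in all variables. -/
theorem exists_local_quotient {F A : (ι → ℂ) → ℂ} {q : ι} (hF : ContDiff ℂ 1 F)
    (hA : Continuous A)
    (haff : ∀ z ζ, F (Function.update z q ζ) = F z + (ζ - z q) * A z) {W : Set (ι → ℂ)}
    (hW : IsOpen W) {D : (ι → ℂ) → ℂ} (hD : ContDiffOn ℂ 1 D W)
    (h0 : ∀ z ∈ W, F z = 0 → D z = 0) {p : ι → ℂ} (hp : p ∈ W) (hFp : F p = 0) (hAp : A p ≠ 0) :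
    ∃ V, IsOpen V ∧ p ∈ V ∧ ∃ H, ContDiffOn ℂ 1 H V ∧ ∀ z ∈ V, F z * H z = D z := by
  have hW' : IsOpen (W ∩ {z | A z ≠ 0}) := hW.inter (isOpen_ne_fun hA continuous_const)
  obtain ⟨ε, hε, hball⟩ := Metric.isOpen_iff.1 hW' p ⟨hp, hAp⟩
  set r := ε / 2 with hr
  have hr0 : 0 < r := by positivity
  have hupd : ∀ z ∈ Metric.ball p r, ∀ ζ ∈ Metric.closedBall (p q) r, Function.update z q ζ ∈ W := by
    intro z hz ζ hζ
    refine (hball ?_).1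
    rw [Metric.mem_ball, dist_pi_lt_iff hε]
    intro k
    by_cases hk : k = q
    · subst hk
      simp only [Function.update_self]
      exact (Metric.mem_closedBall.1 hζ).trans_lt (by linarith)
    · simp only [Function.update_of_ne hk]
      exact (dist_le_pi_dist z p k).trans_lt ((Metric.mem_ball.1 hz).trans (by linarith))
  have hAne : ∀ z ∈ Metric.ball p r, A z ≠ 0 := fun z hz =>
    (hball (Metric.ball_subset_ball (by linarith) hz)).2
  let φ : (ι → ℂ) → ℂ := fun z => z q - F z / A z
  have hφ : ContinuousOn φ (Metric.ball p r) :=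
    (continuous_apply q).continuousOn.sub (hF.continuous.continuousOn.div hA.continuousOn hAne)
  have hfac : ∀ z ∈ Metric.ball p r, ∀ ζ, F (Function.update z q ζ) = A z * (ζ - φ z) := by
    intro z hz ζ
    have := hAne z hz
    rw [haff]
    simp only [φ]
    field_simp
    ring
  let V : Set (ι → ℂ) := Metric.ball p r ∩ φ ⁻¹' Metric.ball (p q) r
  have hV : IsOpen V := hφ.isOpen_inter_preimage Metric.isOpen_ball Metric.isOpen_ball
  have hFW : IsOpen (W ∩ {z | F z ≠ 0}) := hW.inter (isOpen_ne_fun hF.continuous continuous_const)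
  refine ⟨V, hV, ⟨Metric.mem_ball_self hr0, by simp [φ, hFp, hr0]⟩,
    fun z => (2 * Real.pi * Complex.I : ℂ)⁻¹ * ∮ ζ in C(p q, r),
      (ζ - z q)⁻¹ • (fun z => D z / F z) (Function.update z q ζ), ?_, ?_⟩
  · refine contDiffOn_const.mul (contDiffOn_circleIntegral_kernel hFW hV q
      ((hD.mono Set.inter_subset_left).div hF.contDiffOn fun z hz => hz.2) hr0.le ?_)
    intro z hz ζ hζ
    refine ⟨⟨hupd z hz.1 ζ (Metric.sphere_subset_closedBall hζ), ?_⟩, ?_⟩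
    · change F _ ≠ 0
      rw [hfac z hz.1]
      refine mul_ne_zero (hAne z hz.1) (sub_ne_zero.2 ?_)
      rintro rfl
      exact (Metric.mem_ball.1 hz.2).ne (Metric.mem_sphere.1 hζ)
    · rintro rfl
      have := (dist_le_pi_dist z p q).trans_lt (Metric.mem_ball.1 hz.1)
      exact this.ne (Metric.mem_sphere.1 hζ)
  · intro z hz
    have hAz := hAne z hz.1
    let u : ℂ → ℂ := fun ζ => D (Function.update z q ζ)
    have hu : DifferentiableOn ℂ u (Metric.closedBall (p q) r) := fun ζ hζ => by
      have h6 := (hD.contDiffAt (hW.mem_nhds (hupd z hz.1 ζ hζ))).differentiableAt one_ne_zero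
      exact (h6.comp ζ (hasFDerivAt_update z ζ).differentiableAt).differentiableWithinAt
    have hφb : φ z ∈ Metric.ball (p q) r := hz.2
    have huφ : u (φ z) = 0 := h0 _ (hupd z hz.1 _ (Metric.ball_subset_closedBall hφb)) (by
      rw [hfac z hz.1, sub_self, mul_zero])
    have hzq : z q ∈ Metric.ball (p q) r :=
      (dist_le_pi_dist z p q).trans_lt (Metric.mem_ball.1 hz.1)
    -- On the circle `dslope u (φ z)` equals `u ζ / (ζ - φ z)`, because `u (φ z) = 0`; it is
    -- holomorphic on the disc, so Cauchy's formula recovers its value at `z q`.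
    have hds := (Complex.differentiableOn_dslope (mem_of_superset (Metric.isOpen_ball.mem_nhds hφb)
      Metric.ball_subset_closedBall)).2 hu
    have hC := hds.circleIntegral_sub_inv_smul hzq
    have hint : (∮ ζ in C(p q, r), (ζ - z q)⁻¹ • (fun z => D z / F z) (Function.update z q ζ)) =
        (A z)⁻¹ * ∮ ζ in C(p q, r), (ζ - z q)⁻¹ • dslope u (φ z) ζ := by
      rw [← smul_eq_mul, ← circleIntegral.integral_smul]
      refine circleIntegral.integral_congr hr0.le fun ζ hζ => ?_
      have hne : ζ ≠ φ z := by
        rintro rfl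
        exact (Metric.mem_ball.1 hφb).ne (Metric.mem_sphere.1 hζ)
      simp only [dslope_of_ne u hne, slope, vsub_eq_sub, smul_eq_mul, huφ, sub_zero, hfac z hz.1]
      have := sub_ne_zero.2 hne
      simp only [u]
      field_simp
    beta_reduce
    beta_reduce at hint
    rw [hint, hC, smul_eq_mul]
    have hpi : (2 * Real.pi * Complex.I : ℂ) ≠ 0 := Complex.two_pi_I_ne_zero
    have hFz : F z = A z * (z q - φ z) := by
      rw [← hfac z hz.1, Function.update_eq_self]
    have hsm := sub_smul_dslope u (φ z) (z q)
    rw [huφ, sub_zero, smul_eq_mul] at hsm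
    have huz : u (z q) = D z := by simp only [u, Function.update_eq_self]
    rw [← huz, ← hsm, hFz]
    field_simp

/-- Division by a function that is affine in each variable and has a smooth zero set. -/
theorem hasDivision_of_affine {F : (ι → ℂ) → ℂ} {A : ι → (ι → ℂ) → ℂ} (hF : ContDiff ℂ 1 F)
    (hA : ∀ q, Continuous (A q))
    (haff : ∀ q z ζ, F (Function.update z q ζ) = F z + (ζ - z q) * A q z)
    (hne : ∀ p, F p = 0 → ∃ q, A q p ≠ 0) : HasDivision F := by
  intro W D hW hD h0
  have hloc : ∀ p ∈ W, ∃ V, IsOpen V ∧ p ∈ V ∧ ∃ H, ContDiffOn ℂ 1 H V ∧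
      ∀ z ∈ V, F z * H z = D z := by
    intro p hp
    by_cases hFp : F p = 0
    · obtain ⟨q, hq⟩ := hne p hFp
      exact exists_local_quotient hF (hA q) (haff q) hW hD h0 hp hFp hq
    · refine ⟨W ∩ {z | F z ≠ 0}, hW.inter (isOpen_ne_fun hF.continuous continuous_const), ⟨hp, hFp⟩,
        fun z => D z / F z, (hD.mono Set.inter_subset_left).div hF.contDiffOn fun z hz => hz.2,
        fun z hz => mul_div_cancel₀ _ hz.2⟩
  choose! V hV hpV H hH hFH using hloc
  -- Local quotients coincide where `F ≠ 0`. At a zero of `F`, moving in a direction `q` with `A q z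
  -- ≠ 0` makes `F` non-zero at once, and continuity transfers the equality.
  have agree : ∀ p ∈ W, ∀ z ∈ W, z ∈ V p → H z z = H p z := by
    intro p hp z hz hzp
    by_cases hFz : F z = 0
    · obtain ⟨q, hq⟩ := hne z hFz
      have hupd : Continuous fun ζ : ℂ => Function.update z q ζ := continuous_const.update q continuous_id
      have hnear : ∀ᶠ ζ in 𝓝 (z q), Function.update z q ζ ∈ V z ∩ V p := by
        refine hupd.continuousAt.eventually (((hV z hz).inter (hV p hp)).mem_nhds ?_)
        simpa using ⟨hpV z hz, hzp⟩
      have hlim : ∀ y ∈ W, z ∈ V y →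
          Tendsto (fun ζ => H y (Function.update z q ζ)) (𝓝[≠] (z q)) (𝓝 (H y z)) := by
        intro y hy hzy
        have h1 : ContinuousAt (H y) (Function.update z q (z q)) := by
          rw [Function.update_eq_self]
          exact (hH y hy).continuousOn.continuousAt ((hV y hy).mem_nhds hzy)
        have h2 : ContinuousAt (fun ζ => H y (Function.update z q ζ)) (z q) :=
          ContinuousAt.comp (g := H y) h1 hupd.continuousAt
        have h3 := h2.tendsto
        rw [Function.update_eq_self] at h3
        exact h3.mono_left nhdsWithin_le_nhds
      refine tendsto_nhds_unique_of_eventuallyEq (hlim z hz (hpV z hz)) (hlim p hp hzp) ?_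
      filter_upwards [hnear.filter_mono nhdsWithin_le_nhds, self_mem_nhdsWithin] with ζ h1 h2
      have h3 : F (Function.update z q ζ) ≠ 0 := by
        rw [haff, hFz, zero_add]
        exact mul_ne_zero (sub_ne_zero.2 h2) hq
      exact mul_left_cancel₀ h3 ((hFH z hz _ h1.1).trans (hFH p hp _ h1.2).symm)
    · exact mul_left_cancel₀ hFz ((hFH z hz z (hpV z hz)).trans (hFH p hp z hzp).symm)
  refine ⟨fun z => H z z, fun p hp => ?_, fun z hz => hFH z hz z (hpV z hz)⟩
  refine (((hH p hp).contDiffAt ((hV p hp).mem_nhds (hpV p hp))).congr_of_eventuallyEq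
    ?_).contDiffWithinAt
  filter_upwards [(hV p hp).mem_nhds (hpV p hp), hW.mem_nhds hp] with z h1 h2
  exact agree p hp z h2 h1

end Division

/-! ### Polynomial approximation on polydiscs -/

section Approximation

variable {ι : Type} [Fintype ι] [DecidableEq ι]

/-- Partial sums of the Taylor series of a holomorphic function on a disc, with coefficients given
by Cauchy's formula. -/
theorem norm_sub_taylor_le {f : ℂ → ℂ} {R R₁ M : ℝ} (hR : 0 ≤ R) (hRR : R < R₁)
    (hf : DifferentiableOn ℂ f (Metric.closedBall 0 R₁))
    (hM : ∀ ζ ∈ Metric.sphere (0 : ℂ) R₁, ‖f ζ‖ ≤ M) {w : ℂ} (hw : ‖w‖ ≤ R) (m : ℕ) :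
    ‖f w - ∑ k ∈ Finset.range m, ((2 * Real.pi * Complex.I)⁻¹ *
      ∮ ζ in C(0, R₁), (ζ - 0)⁻¹ • ((ζ ^ k)⁻¹ * f ζ)) * w ^ k‖ ≤
      R₁ * (M * (R / R₁) ^ m / (R₁ - R)) := by
  have hR₁ : 0 < R₁ := hR.trans_lt hRR
  have hC := hf.circleIntegral_sub_inv_smul (w := w) (by simpa using hw.trans_lt hRR)
  have hpi : (2 * Real.pi * Complex.I : ℂ) ≠ 0 := Complex.two_pi_I_ne_zero
  have hs0 : ∀ ζ ∈ Metric.sphere (0 : ℂ) R₁, ζ ≠ 0 := fun ζ hζ h => by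
    rw [h] at hζ; simp at hζ; exact hR₁.ne hζ
  have hsw : ∀ ζ ∈ Metric.sphere (0 : ℂ) R₁, ζ - w ≠ 0 := fun ζ hζ h => by
    rw [sub_eq_zero.1 h] at hζ; simp at hζ; linarith
  have hfc : ContinuousOn f (Metric.sphere 0 R₁) :=
    hf.continuousOn.mono Metric.sphere_subset_closedBall
  have hgc : ∀ k : ℕ, ContinuousOn (fun ζ => (ζ - 0)⁻¹ • ((ζ ^ k)⁻¹ * f ζ) * w ^ k)
      (Metric.sphere 0 R₁) := fun k =>
    ContinuousOn.mul (ContinuousOn.smul (ContinuousOn.inv₀ (by fun_prop : ContinuousOn (fun ζ : ℂ => ζ - 0) _)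
      fun ζ hζ => by simpa using hs0 ζ hζ) (ContinuousOn.mul (ContinuousOn.inv₀
        (by fun_prop : ContinuousOn (fun ζ : ℂ => ζ ^ k) _)
        fun ζ hζ => pow_ne_zero _ (hs0 ζ hζ)) hfc)) continuousOn_const
  have hsum : ∑ k ∈ Finset.range m, ((2 * Real.pi * Complex.I)⁻¹ *
      ∮ ζ in C(0, R₁), (ζ - 0)⁻¹ • ((ζ ^ k)⁻¹ * f ζ)) * w ^ k = (2 * Real.pi * Complex.I : ℂ)⁻¹ *
      ∮ ζ in C(0, R₁), ∑ k ∈ Finset.range m, (ζ - 0)⁻¹ • ((ζ ^ k)⁻¹ * f ζ) * w ^ k := by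
    rw [circleIntegral.integral_fun_sum fun k _ => (hgc k).circleIntegrable hR₁.le, Finset.mul_sum]
    refine Finset.sum_congr rfl fun k _ => ?_
    rw [mul_assoc]
    congr 1
    have := circleIntegral.integral_smul (w ^ k) (fun ζ => (ζ - 0)⁻¹ • ((ζ ^ k)⁻¹ * f ζ)) 0 R₁
    simp only [smul_eq_mul] at this ⊢
    rw [mul_comm, ← this]
    simp only [mul_comm]
  have hfw : f w = (2 * Real.pi * Complex.I : ℂ)⁻¹ * ∮ ζ in C(0, R₁), (ζ - w)⁻¹ • f ζ := by
    rw [hC, smul_eq_mul, inv_mul_cancel_left₀ hpi]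
  have hsub := circleIntegral.integral_sub (f := fun ζ => (ζ - w)⁻¹ • f ζ)
    (g := fun ζ => ∑ k ∈ Finset.range m, (ζ - 0)⁻¹ • ((ζ ^ k)⁻¹ * f ζ) * w ^ k) (c := 0) (R := R₁)
    (ContinuousOn.circleIntegrable hR₁.le (ContinuousOn.smul (ContinuousOn.inv₀ (by fun_prop) hsw) hfc))
    (ContinuousOn.circleIntegrable hR₁.le (continuousOn_finsetSum _ fun k _ => hgc k))
  rw [hsum, hfw, ← mul_sub, ← hsub, ← smul_eq_mul]
  refine circleIntegral.norm_two_pi_i_inv_smul_integral_le_of_norm_le_const hR₁.le fun ζ hζ => ?_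
  have h0 := hs0 ζ hζ
  have h1 := hsw ζ hζ
  -- The remainder of the geometric series for `1 / (ζ - w)` after `m` terms is `(w / ζ) ^ m / (ζ -
  -- w)`.
  have hid : (ζ - w)⁻¹ • f ζ - ∑ k ∈ Finset.range m, (ζ - 0)⁻¹ • ((ζ ^ k)⁻¹ * f ζ) * w ^ k =
      f ζ * (w / ζ) ^ m / (ζ - w) := by
    have h2 : ∑ k ∈ Finset.range m, (ζ - 0)⁻¹ • ((ζ ^ k)⁻¹ * f ζ) * w ^ k =
        ζ⁻¹ * f ζ * ∑ k ∈ Finset.range m, (w / ζ) ^ k := by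
      rw [Finset.mul_sum]
      refine Finset.sum_congr rfl fun k _ => ?_
      rw [smul_eq_mul, sub_zero, div_pow]
      field_simp
    have h3 : w / ζ ≠ 1 := fun h => h1 (by rw [div_eq_one_iff_eq h0] at h; rw [h, sub_self])
    rw [h2, geom_sum_eq h3, smul_eq_mul]
    have h4 : w / ζ - 1 = -(ζ - w) / ζ := by field_simp; ring
    rw [h4]
    field_simp
    ring
  have hζn : ‖ζ‖ = R₁ := by simpa using hζ
  rw [hid, norm_div, norm_mul, norm_pow, norm_div, hζn]
  have hsub : R₁ - R ≤ ‖ζ - w‖ := by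
    have := norm_sub_norm_le ζ w
    rw [hζn] at this
    linarith
  have hM0 : 0 ≤ M := (norm_nonneg _).trans (hM ζ hζ)
  have : 0 < R₁ - R := sub_pos.2 hRR
  gcongr
  exact hM ζ hζ

/-- A function holomorphic near a closed polydisc is a uniform limit of polynomials there. -/
theorem exists_polynomial_approx {U : Set (ι → ℂ)} (hU : IsOpen U) {R : ℝ} (hR : 0 ≤ R)
    (hRU : Metric.closedBall 0 R ⊆ U) {G : (ι → ℂ) → ℂ} (hG : ContDiffOn ℂ 1 G U) {ε : ℝ}
    (hε : 0 < ε) :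
    ∃ p : MvPolynomial ι ℂ, ∀ z ∈ Metric.closedBall (0 : ι → ℂ) R,
      ‖G z - MvPolynomial.eval z p‖ < ε := by
  -- Induction on the set of coordinates allowed to be non-zero. The open set and the function vary,
  -- since the step applies the hypothesis to Taylor coefficients on a smaller domain.
  have main : ∀ (s : Finset ι) (U : Set (ι → ℂ)), IsOpen U → Metric.closedBall 0 R ⊆ U →
      ∀ G : (ι → ℂ) → ℂ, ContDiffOn ℂ 1 G U → ∀ ε : ℝ, 0 < ε → ∃ p : MvPolynomial ι ℂ,
        ∀ z ∈ Metric.closedBall (0 : ι → ℂ) R, (∀ k ∉ s, z k = 0) →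
          ‖G z - MvPolynomial.eval z p‖ < ε := by
    intro s
    induction s using Finset.induction_on with
    | empty =>
      intro U hU hRU G hG ε hε
      refine ⟨MvPolynomial.C (G 0), fun z _ hz => ?_⟩
      have : z = 0 := funext fun k => hz k (by simp)
      simpa [this] using hε
    | insert j s hj ih =>
      intro U hU hRU G hG ε hε
      obtain ⟨δ, hδ, hδU⟩ := (isCompact_closedBall (0 : ι → ℂ) R).exists_thickening_subset_open hU hRU
      set R₁ := R + δ / 2 with hR₁
      have hRR : R < R₁ := by linarith
      have hR₁0 : 0 < R₁ := by linarith
      have hbU : Metric.closedBall (0 : ι → ℂ) R₁ ⊆ U := fun z hz => hδU (by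
        rw [thickening_closedBall hδ hR, Metric.mem_ball]
        exact (Metric.mem_closedBall.1 hz).trans_lt (by linarith))
      obtain ⟨M, hM⟩ := (isCompact_closedBall (0 : ι → ℂ) R₁).exists_bound_of_continuousOn
        (hG.continuousOn.mono hbU)
      have hupd : ∀ z ∈ Metric.closedBall (0 : ι → ℂ) R₁, ∀ ζ ∈ Metric.closedBall (0 : ℂ) R₁,
          Function.update z j ζ ∈ Metric.closedBall (0 : ι → ℂ) R₁ := by
        intro z hz ζ hζ
        rw [mem_closedBall_zero_iff, pi_norm_le_iff_of_nonneg hR₁0.le] at hz ⊢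
        intro k
        by_cases hk : k = j
        · subst hk; simpa using hζ
        · simpa [hk] using hz k
      have hlim : Tendsto (fun m : ℕ => R₁ * (M * (R / R₁) ^ m / (R₁ - R))) atTop (𝓝 0) := by
        have := tendsto_pow_atTop_nhds_zero_of_lt_one (div_nonneg hR hR₁0.le)
          ((div_lt_one hR₁0).2 hRR)
        simpa using (((this.const_mul M).div_const (R₁ - R)).const_mul R₁)
      obtain ⟨m, hm⟩ := (hlim.eventually (Iio_mem_nhds (half_pos hε))).exists
      let c : ℕ → (ι → ℂ) → ℂ := fun k z => (2 * Real.pi * Complex.I : ℂ)⁻¹ *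
        ∮ ζ in C(0, R₁), (ζ - 0)⁻¹ • ((ζ ^ k)⁻¹ * G (Function.update z j ζ))
      have hc : ∀ k, ∃ p : MvPolynomial ι ℂ, ∀ z ∈ Metric.closedBall (0 : ι → ℂ) R,
          (∀ k ∉ s, z k = 0) →
          -- The factor `(R + 1) ^ k` absorbs `‖z j‖ ^ k`, and `m + 1` absorbs the number of terms;
          -- the added ones keep the denominator positive.
          ‖c k z - MvPolynomial.eval z p‖ < ε / 2 / ((m + 1) * (R + 1) ^ k) := by
        intro k
        let V : Set (ι → ℂ) := Metric.ball 0 R₁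
        -- `H` puts the `k`-th coefficient into Cauchy-kernel form; the two agree when `z j = 0`,
        -- the only case used.
        let H : (ι → ℂ) → ℂ := fun z => (2 * Real.pi * Complex.I : ℂ)⁻¹ * ∮ ζ in C(0, R₁),
          (ζ - z j)⁻¹ • (fun z : ι → ℂ => (z j ^ k)⁻¹ * G z) (Function.update z j ζ)
        have hH : ContDiffOn ℂ 1 H V := by
          refine contDiffOn_const.mul (contDiffOn_circleIntegral_kernel
            (W := U ∩ {z | z j ≠ 0})
            (hU.inter (isOpen_ne_fun (continuous_apply j) continuous_const)) Metric.isOpen_ball j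
            (ContDiffOn.mul (ContDiffOn.inv (by fun_prop) fun z hz => pow_ne_zero _ hz.2)
              (hG.mono Set.inter_subset_left)) hR₁0.le fun z hz ζ hζ => ⟨⟨?_, ?_⟩, ?_⟩)
          · exact hbU (hupd z (Metric.ball_subset_closedBall hz) ζ
              (Metric.sphere_subset_closedBall hζ))
          · change Function.update z j ζ j ≠ 0
            rw [Function.update_self]
            rintro rfl
            simp at hζ
            exact hR₁0.ne hζ
          · rintro rfl
            have h1 := norm_le_pi_norm z j
            rw [mem_ball_zero_iff] at hz
            rw [mem_sphere_zero_iff_norm] at hζ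
            linarith
        obtain ⟨p, hp⟩ := ih V Metric.isOpen_ball (Metric.closedBall_subset_ball hRR) H hH
          (ε / 2 / ((m + 1) * (R + 1) ^ k)) (by positivity)
        refine ⟨p, fun z hz hzs => ?_⟩
        have := hp z hz hzs
        simpa only [H, hzs j hj, Function.update_self] using this
      choose p hp using hc
      -- Each `p k` is controlled only where the coordinate `j` vanishes, so `0` is substituted for
      -- `X j` in it before multiplying by the power of `X j`.
      refine ⟨∑ k ∈ Finset.range m, MvPolynomial.bind₁ (Function.update MvPolynomial.X j 0) (p k) *
        MvPolynomial.X j ^ k, fun z hz hzs => ?_⟩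
      have hz' := hz
      rw [mem_closedBall_zero_iff, pi_norm_le_iff_of_nonneg hR] at hz'
      set w := Function.update z j 0 with hw
      have hwR : w ∈ Metric.closedBall (0 : ι → ℂ) R := by
        rw [mem_closedBall_zero_iff, pi_norm_le_iff_of_nonneg hR]
        intro k
        by_cases hk : k = j
        · subst hk; simpa [hw] using hR
        · simpa [hw, hk] using hz' k
      have hws : ∀ k ∉ s, w k = 0 := fun k hk => by
        by_cases hkj : k = j
        · subst hkj; simp [hw]
        · simpa [hw, hkj] using hzs k (by simp [hkj, hk])
      have hwR₁ : w ∈ Metric.closedBall (0 : ι → ℂ) R₁ := Metric.closedBall_subset_closedBall hRR.le hwR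
      have hT := norm_sub_taylor_le (f := fun ζ => G (Function.update w j ζ)) (M := M) hR hRR
        (fun ζ hζ => by
          have h6 := (hG.contDiffAt (hU.mem_nhds (hbU (hupd w hwR₁ ζ hζ)))).differentiableAt one_ne_zero
          exact (h6.comp ζ (hasFDerivAt_update w ζ).differentiableAt).differentiableWithinAt)
        (fun ζ hζ => hM _ (hupd w hwR₁ ζ (Metric.sphere_subset_closedBall hζ))) (hz' j) m
      have hwz : Function.update w j (z j) = z := by simp [hw]
      beta_reduce at hT
      rw [hwz] at hT
      have hev : MvPolynomial.eval z (∑ k ∈ Finset.range m,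
          MvPolynomial.bind₁ (Function.update MvPolynomial.X j 0) (p k) * MvPolynomial.X j ^ k) =
          ∑ k ∈ Finset.range m, MvPolynomial.eval w (p k) * z j ^ k := by
        rw [map_sum]
        refine Finset.sum_congr rfl fun k _ => ?_
        rw [map_mul, map_pow, MvPolynomial.eval_X, ← MvPolynomial.coe_aeval_eq_eval,
          RingHom.coe_coe, MvPolynomial.aeval_bind₁, MvPolynomial.aeval_eq_eval]
        congr 3
        funext i
        by_cases hi : i = j
        · subst hi; simp [hw]
        · simp [hw, hi]
      have hS : ‖∑ k ∈ Finset.range m, c k w * z j ^ k -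
          ∑ k ∈ Finset.range m, MvPolynomial.eval w (p k) * z j ^ k‖ ≤ ε / 2 := by
        rw [← Finset.sum_sub_distrib]
        have hb : ∀ k ∈ Finset.range m, ‖c k w * z j ^ k - MvPolynomial.eval w (p k) * z j ^ k‖ ≤
            ε / 2 / (m + 1) := by
          intro k _
          rw [← sub_mul, norm_mul, norm_pow]
          have h1 : ‖z j‖ ^ k ≤ (R + 1) ^ k := by gcongr; linarith [hz' j]
          have h2 := (hp k w hwR hws).le
          have h3 : 0 < (R + 1) ^ k := by positivity
          calc _ ≤ ε / 2 / ((m + 1) * (R + 1) ^ k) * (R + 1) ^ k := by gcongr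
            _ = ε / 2 / (m + 1) := by field_simp
        refine (norm_sum_le_of_le _ hb).trans ?_
        rw [Finset.sum_const, Finset.card_range, nsmul_eq_mul, ← mul_div_assoc, div_le_iff₀ (by positivity)]
        nlinarith
      rw [hev]
      have htri := norm_add_le (G z - ∑ k ∈ Finset.range m, c k w * z j ^ k)
        (∑ k ∈ Finset.range m, c k w * z j ^ k -
          ∑ k ∈ Finset.range m, MvPolynomial.eval w (p k) * z j ^ k)
      rw [sub_add_sub_cancel] at htri
      have hm' : R₁ * (M * (R / R₁) ^ m / (R₁ - R)) < ε / 2 := hm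
      have hT' : ‖G z - ∑ k ∈ Finset.range m, c k w * z j ^ k‖ ≤ _ := hT
      linarith
  obtain ⟨p, hp⟩ := main Finset.univ U hU hRU G hG ε hε
  exact ⟨p, fun z hz => hp z hz (by simp)⟩

end Approximation

/-! ### Vector fields that flow along straight lines -/

section LinearFlow

variable {E : Type} [NormedAddCommGroup E] [NormedSpace ℂ E] {X : Set E}

theorem hasDerivAt_line (x v : E) (τ : ℂ) : HasDerivAt (fun s : ℂ => x + s • v) v τ := by
  simpa using ((hasDerivAt_id τ).smul_const v).const_add x

/-- The direction of a line contained in `X` is tangent to `X`. -/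
theorem mem_tangentSpace_of_line {x v : E} (h : ∀ τ : ℂ, x + τ • v ∈ X) : v ∈ tangentSpace X x := by
  intro g hg hgX
  have h0 : x + (0 : ℂ) • v = x := by simp
  have hl := hasDerivAt_line x v 0
  have h1 : HasDerivAt (fun s : ℂ => g (x + s • v)) (fderiv ℂ g x v) 0 := by
    have hg' : HasFDerivAt g (fderiv ℂ g x) (x + (0 : ℂ) • v) := by
      rw [h0]; exact hg.differentiableAt.hasFDerivAt
    exact hg'.comp_hasDerivAt (0 : ℂ) hl
  have h2 : Tendsto (fun s : ℂ => x + s • v) (𝓝 0) (𝓝[X] x) := by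
    refine tendsto_nhdsWithin_iff.2 ⟨?_, Eventually.of_forall h⟩
    have := hl.continuousAt.tendsto
    rwa [h0] at this
  have h3 : (fun s : ℂ => g (x + s • v)) =ᶠ[𝓝 0] fun _ => 0 := h2.eventually hgX
  exact h1.unique ((hasDerivAt_const (0 : ℂ) (0 : ℂ)).congr_of_eventuallyEq h3)

/-- The field `V` is constant along the lines `τ ↦ x + τ V(x)`, and these lie in `X`. -/
def HolVF.HasLinearFlow (V : HolVF X) : Prop :=
  ∃ γ : X → ℂ → X, ∀ x τ, (γ x τ : E) = x + τ • V.toFun x ∧ V.toFun (γ x τ) = V.toFun x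

theorem HolVF.HasLinearFlow.isComplete {V : HolVF X} (h : V.HasLinearFlow) : V.IsComplete := by
  obtain ⟨γ, hγ⟩ := h
  refine fun x => ⟨γ x, Subtype.ext (by simp [(hγ x 0).1]), fun t => ?_⟩
  rw [(hγ x t).2]
  simpa only [(hγ x _).1] using hasDerivAt_line (x : E) (V.toFun x) t

/-- The velocity of the line is `V` at each of its points, so the Lie derivative becomes a
derivative in `τ`; invariance and nilpotency reduce to one complex variable. -/
theorem HolVF.hasDerivAt_along_flow {V : HolVF X} {γ : X → ℂ → X}
    (hγ : ∀ x τ, (γ x τ : E) = x + τ • V.toFun x ∧ V.toFun (γ x τ) = V.toFun x) (f : HolFun X)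
    (x : X) (τ : ℂ) : HasDerivAt (fun s => f.1 (γ x s)) ((V.lie f).1 (γ x τ)) τ := by
  obtain ⟨g, hg, hgf⟩ := f.2 (γ x τ)
  have hl := hasDerivAt_line (x : E) (V.toFun x) τ
  have hc : ContinuousAt (γ x) τ := by
    rw [Topology.IsInducing.subtypeVal.continuousAt_iff]
    simpa only [Function.comp_def, (hγ x _).1] using hl.continuousAt
  have h1 : (V.lie f).1 (γ x τ) = fderiv ℂ g (γ x τ) (V.toFun x) := by
    rw [← (hγ x τ).2]
    exact V.derivAt_eq f _ g hg hgf
  have h2 : HasDerivAt (fun s : ℂ => g (x + s • V.toFun x)) ((V.lie f).1 (γ x τ)) τ := by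
    rw [h1]
    have hg' : HasFDerivAt g (fderiv ℂ g (γ x τ)) ((x : E) + τ • V.toFun x) := by
      rw [← (hγ x τ).1]; exact hg.differentiableAt.hasFDerivAt
    exact hg'.comp_hasDerivAt τ hl
  refine h2.congr_of_eventuallyEq ?_
  filter_upwards [hc.eventually hgf] with s hs
  rw [← hs, (hγ x s).1]

theorem HolVF.lie_eq_zero_of_flow {V : HolVF X} {γ : X → ℂ → X}
    (hγ : ∀ x τ, (γ x τ : E) = x + τ • V.toFun x ∧ V.toFun (γ x τ) = V.toFun x) {f : HolFun X}
    (hf : ∀ x τ, f.1 (γ x τ) = f.1 x) : V.lie f = 0 := by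
  ext x
  have h1 := hasDerivAt_along_flow hγ f x 0
  simp only [hf] at h1
  have h2 : γ x 0 = x := Subtype.ext (by simp [(hγ x 0).1])
  rw [h2] at h1
  exact h1.unique (hasDerivAt_const _ _)

end LinearFlow

/-! ### Regular functions under a linear flow -/

section Polynomials

variable {σ : Type} [Fintype σ] {X : Set (σ → ℂ)}

theorem analyticAt_eval (p : MvPolynomial σ ℂ) (x : σ → ℂ) :
    AnalyticAt ℂ (fun y => MvPolynomial.eval y p) x := by
  have := AnalyticAt.aeval_mvPolynomial (𝕜 := ℂ) (f := fun y : σ → ℂ => y) (z := x)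
    (fun i => (ContinuousLinearMap.proj (R := ℂ) (φ := fun _ : σ => ℂ) i).analyticAt x) p
  simpa [MvPolynomial.aeval_eq_eval] using this

theorem isHol_eval (X : Set (σ → ℂ)) (p : MvPolynomial σ ℂ) :
    IsHol X fun x => MvPolynomial.eval x.1 p :=
  fun x => ⟨_, analyticAt_eval p x, Eventually.of_forall fun _ => rfl⟩

/-- The regular function on `X` given by a polynomial. -/
noncomputable def polyFun (X : Set (σ → ℂ)) (p : MvPolynomial σ ℂ) : HolFun X :=
  ⟨⟨_, (isHol_eval X p).continuous⟩, isHol_eval X p⟩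

@[simp]
theorem polyFun_apply (p : MvPolynomial σ ℂ) (x : X) :
    (polyFun X p).1 x = MvPolynomial.eval x.1 p := rfl

theorem HolVF.lie_polyFun_X (V : HolVF X) (i : σ) (x : X) :
    (V.lie (polyFun X (MvPolynomial.X i))).1 x = V.toFun x i := by
  have h := V.derivAt_eq (polyFun X (MvPolynomial.X i)) x
    (ContinuousLinearMap.proj (R := ℂ) (φ := fun _ : σ => ℂ) i)
    ((ContinuousLinearMap.proj (R := ℂ) (φ := fun _ : σ => ℂ) i).analyticAt x)
    (Eventually.of_forall fun y => by simp)
  rw [ContinuousLinearMap.fderiv] at h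
  exact h

/-- Along each line `p` is a polynomial in `τ` and `V` acts as `d/dτ`. Its degree is at most
`p.totalDegree`, so a single exponent works for all lines. -/
theorem HolVF.HasLinearFlow.isLocallyNilpotent {V : HolVF X} (h : V.HasLinearFlow) :
    IsLocallyNilpotent V := by
  obtain ⟨γ, hγ⟩ := h
  rintro f ⟨p, hp⟩
  let Q : X → Polynomial ℂ := fun x => MvPolynomial.aeval (fun i =>
    Polynomial.C (x.1 i) + Polynomial.X * Polynomial.C (V.toFun x i)) p
  have hQ : ∀ x τ, (Q x).eval τ = MvPolynomial.eval (x.1 + τ • V.toFun x) p := by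
    intro x τ
    have := MvPolynomial.map_aeval (fun i => Polynomial.C (x.1 i) + Polynomial.X *
      Polynomial.C (V.toFun x i)) (Polynomial.evalRingHom τ) p
    simp only [Polynomial.coe_evalRingHom] at this
    rw [this, MvPolynomial.eval, MvPolynomial.coe_eval₂Hom, MvPolynomial.coe_eval₂Hom]
    congr 1
    · ext; simp
    · funext i
      simp only [Polynomial.eval_add, Polynomial.eval_C, Polynomial.eval_mul, Polynomial.eval_X,
        Pi.add_apply, Pi.smul_apply, smul_eq_mul]
  have hdeg : ∀ x, (Q x).natDegree ≤ p.totalDegree := by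
    intro x
    have h1 : ∀ i, (Polynomial.C (x.1 i) + Polynomial.X * Polynomial.C (V.toFun x i)).natDegree ≤ 1 :=
      fun i => (Polynomial.natDegree_add_le _ _).trans (max_le (by simp)
        (Polynomial.natDegree_mul_le.trans (by simp)))
    have h2 := MvPolynomial.aeval_natDegree_le p le_rfl _ h1
    rwa [mul_one] at h2
  have key : ∀ k x τ, ((V.lie ^ k) f).1 (γ x τ) = ((Polynomial.derivative^[k]) (Q x)).eval τ := by
    intro k
    induction k with
    | zero =>
      intro x τ
      simp [hp, hQ, (hγ x τ).1]
    | succ k ih =>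
      intro x τ
      have h1 := V.hasDerivAt_along_flow hγ ((V.lie ^ k) f) x τ
      simp only [ih] at h1
      rw [pow_succ', Module.End.mul_apply, Function.iterate_succ_apply']
      exact h1.unique (Polynomial.hasDerivAt _ _)
  refine ⟨p.totalDegree + 1, ?_⟩
  ext x
  have h2 : γ x 0 = x := Subtype.ext (by simp [(hγ x 0).1])
  have := key (p.totalDegree + 1) x 0
  rw [h2, Polynomial.iterate_derivative_eq_zero (Nat.lt_succ_of_le (hdeg x)), Polynomial.eval_zero] at this
  exact this

theorem HolVF.HasLinearFlow.lie_monomial {V : HolVF X} (h : V.HasLinearFlow) {m : σ →₀ ℕ}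
    (hm : ∀ i ∈ m.support, ∀ x, V.toFun x i = 0) (c : ℂ) :
    V.lie (polyFun X (MvPolynomial.monomial m c)) = 0 := by
  obtain ⟨γ, hγ⟩ := h
  refine HolVF.lie_eq_zero_of_flow hγ fun x τ => ?_
  simp only [polyFun_apply, MvPolynomial.eval_monomial, Finsupp.prod]
  congr 1
  refine Finset.prod_congr rfl fun i hi => ?_
  simp [(hγ x τ).1, hm i hi x]

theorem polyFun_mem_of_monomial {S : Submodule ℂ (HolFun X)}
    (h : ∀ m c, polyFun X (MvPolynomial.monomial m c) ∈ S) (p : MvPolynomial σ ℂ) :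
    polyFun X p ∈ S := by
  induction p using MvPolynomial.induction_on' with
  | monomial m c => exact h m c
  | add p q hp hq =>
    have : polyFun X (p + q) = polyFun X p + polyFun X q := by
      ext x
      exact map_add (MvPolynomial.eval x.1) p q
    rw [this]
    exact S.add_mem hp hq

end Polynomials

/-! ### Density of polynomials on a hypersurface -/

section Density

variable {ι : Type} [Fintype ι] [DecidableEq ι]

/-- Polynomials are dense in the holomorphic functions on a smooth hypersurface whose equation is
affine in each variable. -/
theorem mem_closure_range_polyFun {F : (ι → ℂ) → ℂ} {A : ι → (ι → ℂ) → ℂ} {X : Set (ι → ℂ)}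
    (hX : ∀ z, z ∈ X ↔ F z = 0) (hF : ContDiff ℂ 1 F) (hA : ∀ q, Continuous (A q))
    (haff : ∀ q z ζ, F (Function.update z q ζ) = F z + (ζ - z q) * A q z)
    (hne : ∀ p, F p = 0 → ∃ q, A q p ≠ 0) (f : HolFun X) :
    f ∈ closure (Set.range (polyFun X)) := by
  classical
  have hdiv := hasDivision_of_affine hF hA haff hne
  let f₀ : (ι → ℂ) → ℂ := fun z => if h : z ∈ X then f.1 ⟨z, h⟩ else 0
  have hf₀ : ∀ x : X, f₀ x = f.1 x := fun x => by simp [f₀]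
  have hloc : ∀ p, ExtendsNear F f₀ {p} := by
    intro p
    by_cases hp : F p = 0
    · obtain ⟨g, hg, hgf⟩ := f.2 ⟨p, (hX p).2 hp⟩
      have h1 : ∀ᶠ y in 𝓝 p, ∀ h : y ∈ X, g y = f.1 ⟨y, h⟩ := by
        rw [nhds_subtype_eq_comap, eventually_comap] at hgf
        filter_upwards [hgf] with y hy h using hy ⟨y, h⟩ rfl
      obtain ⟨U, hU, hUo, hpU⟩ := eventually_nhds_iff.1 (hg.eventually_analyticAt.and h1)
      refine ⟨U, hUo, by simpa using hpU, g, fun z hz => (hU z hz).1.contDiffAt.contDiffWithinAt,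
        fun z hz h0 => ?_⟩
      rw [(hU z hz).2 ((hX z).2 h0)]
      exact (hf₀ ⟨z, (hX z).2 h0⟩).symm
    · exact ⟨{z | F z ≠ 0}, isOpen_ne_fun hF.continuous continuous_const, by simpa using hp,
        fun _ => 0, contDiffOn_const, fun z hz h0 => (hz h0).elim⟩
  -- Every compact subset of `X` is bounded, so an exhaustion by balls with errors `1 / (m + 1)`
  -- yields convergence in the compact-open topology.
  have happ : ∀ m : ℕ, ∃ p : MvPolynomial ι ℂ, ∀ x : X, ‖x.1‖ ≤ m →
      ‖f.1 x - MvPolynomial.eval x.1 p‖ < 1 / ((m : ℝ) + 1) := by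
    intro m
    have hm : (0 : ℝ) ≤ m := Nat.cast_nonneg m
    obtain ⟨U, hU, hBU, G, hG, hGf⟩ := ExtendsNear.box hF hdiv hloc (a := -m) (b := m) (c := -m)
      (d := m) (by linarith) (by linarith)
    obtain ⟨p, hp⟩ := exists_polynomial_approx hU hm (fun z hz => hBU fun k _ => by
      rw [mem_closedBall_zero_iff] at hz
      have := (norm_le_pi_norm z k).trans hz
      exact ⟨abs_le.1 ((Complex.abs_re_le_norm _).trans this),
        abs_le.1 ((Complex.abs_im_le_norm _).trans this)⟩) hG (ε := 1 / ((m : ℝ) + 1)) (by positivity)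
    refine ⟨p, fun x hx => ?_⟩
    have hxm : x.1 ∈ Metric.closedBall (0 : ι → ℂ) m := by simpa using hx
    have h1 := hGf x (hBU fun k _ => by
      have := (norm_le_pi_norm x.1 k).trans hx
      exact ⟨abs_le.1 ((Complex.abs_re_le_norm _).trans this),
        abs_le.1 ((Complex.abs_im_le_norm _).trans this)⟩) ((hX x).1 x.2)
    rw [← hf₀ x, ← h1]
    exact hp x hxm
  choose p hp using happ
  refine mem_closure_of_tendsto (f := fun m => polyFun X (p m)) (b := atTop) ?_
    (Eventually.of_forall fun m => ⟨p m, rfl⟩)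
  rw [tendsto_subtype_rng, ContinuousMap.tendsto_iff_forall_isCompact_tendstoUniformlyOn]
  intro K hK
  rw [Metric.tendstoUniformlyOn_iff]
  intro ε hε
  obtain ⟨C, hC⟩ := hK.exists_bound_of_continuousOn (f := fun x : X => x.1)
    continuous_subtype_val.continuousOn
  have h1 : ∀ᶠ m : ℕ in atTop, C ≤ m := (tendsto_natCast_atTop_atTop (R := ℝ)).eventually_ge_atTop C
  have h2 : ∀ᶠ m : ℕ in atTop, 1 / ((m : ℝ) + 1) < ε :=
    tendsto_one_div_add_atTop_nhds_zero_nat.eventually (Iio_mem_nhds hε)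
  filter_upwards [h1, h2] with m hm1 hm2 x hx
  rw [dist_eq_norm]
  exact (hp m x ((hC x hx).trans hm1)).trans hm2

end Density

/-! ### The dependence of `P_i` on its variables -/

section Fibration

variable {K n : ℕ}

theorem M_apply_self (L : Fin K) (Z : Idx K n → ℂ) (k : Fin n) : M L Z k k = 1 := by
  simp [M]

theorem M_apply_of_not_isPos (L : Fin K) (Z : Idx K n → ℂ) {k l : Fin n} (hkl : k ≠ l)
    (h : ¬ IsPos K n (L, k, l)) : M L Z k l = 0 := by
  simp [M, hkl, h]

theorem M_isTriangular (L : Fin K) (Z : Idx K n → ℂ) :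
    (Even (L : ℕ) ∧ (M L Z).BlockTriangular OrderDual.toDual) ∨
      (¬ Even (L : ℕ) ∧ (M L Z).BlockTriangular id) := by
  by_cases hL : Even (L : ℕ)
  · refine Or.inl ⟨hL, fun k l hkl => ?_⟩
    have h : k < l := hkl
    exact M_apply_of_not_isPos L Z h.ne (by simpa [IsPos, hL] using h.le)
  · refine Or.inr ⟨hL, fun k l hkl => ?_⟩
    have h : l < k := hkl
    exact M_apply_of_not_isPos L Z h.ne' (by simpa [IsPos, hL] using h.le)

theorem det_M (L : Fin K) (Z : Idx K n → ℂ) : (M L Z).det = 1 := by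
  rcases M_isTriangular L Z with ⟨-, h⟩ | ⟨-, h⟩
  · rw [Matrix.det_of_isLowerTriangular _ h]
    simp [M_apply_self]
  · rw [Matrix.det_of_isUpperTriangular h]
    simp [M_apply_self]

theorem isUnit_det_M (L : Fin K) (Z : Idx K n → ℂ) : IsUnit (M L Z).det := by
  simp [det_M]

/-- The inverse is triangular of the same type, and transposing the position of a variable leads to
the opposite triangle. This kills all second-order terms below. -/
theorem inv_M_apply_eq_zero (L : Fin K) (Z : Idx K n → ℂ) {k l : Fin n}
    (h : IsPos K n (L, k, l)) : (M L Z)⁻¹ l k = 0 := by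
  have := (M L Z).invertibleOfIsUnitDet (isUnit_det_M L Z)
  rcases M_isTriangular L Z with ⟨hL, hM⟩ | ⟨hL, hM⟩
  · refine Matrix.blockTriangular_inv_of_blockTriangular hM (show l < k from ?_)
    simpa [IsPos, hL] using h
  · refine Matrix.blockTriangular_inv_of_blockTriangular hM (show k < l from ?_)
    simpa [IsPos, hL] using h

/-- The inverse of `B + D` when `D B⁻¹ D = 0`. -/
theorem inv_add_of_mul_inv_mul_eq_zero {B D : Matrix (Fin n) (Fin n) ℂ} (hB : IsUnit B.det)
    (hD : D * B⁻¹ * D = 0) : (B + D)⁻¹ = B⁻¹ - B⁻¹ * D * B⁻¹ := by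
  refine Matrix.inv_eq_right_inv ?_
  have h1 : B * B⁻¹ = 1 := Matrix.mul_nonsing_inv B hB
  have h2 : (B + D) * (B⁻¹ - B⁻¹ * D * B⁻¹) =
      B * B⁻¹ + D * B⁻¹ - (B * B⁻¹) * D * B⁻¹ - (D * B⁻¹ * D) * B⁻¹ := by noncomm_ring
  rw [h2, hD, h1]
  noncomm_ring

theorem M_add_single (L : Fin K) (Z : Idx K n → ℂ) (q : Idx K n) (s : ℂ) :
    M L (Z + s • Pi.single q 1) =
      M L Z + if L = q.1.1 then s • Matrix.single q.1.2.1 q.1.2.2 (1 : ℂ) else 0 := by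
  obtain ⟨⟨L', k', l'⟩, hq⟩ := q
  have hne : k' ≠ l' := by
    rintro rfl
    revert hq
    simp [IsPos]
  ext k l
  by_cases hL : L = L'
  · subst hL
    simp only [if_true, Matrix.add_apply, Matrix.smul_apply, Matrix.single_apply, M, Matrix.of_apply,
      Pi.add_apply, Pi.smul_apply, smul_eq_mul]
    by_cases hkl : k = l
    · subst hkl
      have : ¬ (k' = k ∧ l' = k) := fun h => hne (h.1.trans h.2.symm)
      simp [this]
    · by_cases hp : IsPos K n (L, k, l)
      · simp only [hkl, hp, if_false, dif_pos]
        by_cases he : k' = k ∧ l' = l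
        · obtain ⟨rfl, rfl⟩ := he
          simp
        · have : (⟨(L, k, l), hp⟩ : Idx K n) ≠ ⟨(L, k', l'), hq⟩ := fun h => he (by
            simp only [Subtype.mk.injEq, Prod.mk.injEq] at h
            exact ⟨h.2.1.symm, h.2.2.symm⟩)
          simp [he, this]
      · have : ¬ (k' = k ∧ l' = l) := fun h => hp (by rw [← h.1, ← h.2]; exact hq)
        simp [hkl, hp, this]
  · simp only [hL, if_false, add_zero, M, Matrix.of_apply, Pi.add_apply, Pi.smul_apply, smul_eq_mul]
    by_cases hp : IsPos K n (L, k, l)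
    · have : (⟨(L, k, l), hp⟩ : Idx K n) ≠ ⟨(L', k', l'), hq⟩ := fun h => hL (by
        simp only [Subtype.mk.injEq, Prod.mk.injEq] at h
        exact h.1)
      simp [this]
    · simp [hp]

/-- `P_i` as a polynomial in the variables. -/
theorem exists_polynomial_P (K n : ℕ) (i : Fin n) :
    ∃ p : MvPolynomial (Idx K n) ℂ, ∀ Z, P K n Z i = MvPolynomial.eval Z p := by
  let B : Fin K → Matrix (Fin n) (Fin n) (MvPolynomial (Idx K n) ℂ) := fun L =>
    Matrix.of fun k l => if k = l then 1 else if h : IsPos K n (L, k, l) then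
      MvPolynomial.X ⟨(L, k, l), h⟩ else 0
  -- The determinants are `1`, so adjugates serve as polynomial inverses.
  refine ⟨Matrix.vecMul (fun k => MvPolynomial.C (eLast n k))
    (List.ofFn fun L => (B L).adjugate).prod i, fun Z => ?_⟩
  have hB : ∀ L, (MvPolynomial.eval Z).mapMatrix (B L) = M L Z := by
    intro L
    ext k l
    simp only [RingHom.mapMatrix_apply, Matrix.map_apply, B, M, Matrix.of_apply]
    split_ifs <;> simp
  have hprod : (MvPolynomial.eval Z).mapMatrix (List.ofFn fun L => (B L).adjugate).prod =
      (List.ofFn fun L : Fin K => (M L Z)⁻¹).prod := by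
    rw [map_list_prod, List.map_ofFn]
    congr 2
    funext L
    rw [Function.comp_apply, RingHom.map_adjugate, hB, Matrix.inv_def, det_M]
    simp
  rw [P, ← hprod]
  simp [Matrix.vecMul, dotProduct]

theorem contDiff_P (i : Fin n) (m : WithTop ℕ∞) : ContDiff ℂ m fun Z => P K n Z i := by
  obtain ⟨p, hp⟩ := exists_polynomial_P K n i
  simp only [hp]
  exact contDiff_iff_contDiffAt.2 fun Z => (analyticAt_eval p Z).contDiffAt

theorem analyticAt_P (i : Fin n) (Z : Idx K n → ℂ) : AnalyticAt ℂ (fun Z => P K n Z i) Z := by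
  obtain ⟨p, hp⟩ := exists_polynomial_P K n i
  simp only [hp]
  exact analyticAt_eval p Z

/-- `P_i` is affine in two variables of one factor that stand in the same row or column. -/
theorem exists_P_add_single_add_single (i : Fin n) {q r : Idx K n} (hL : q.1.1 = r.1.1)
    (hkl : q.1.2.1 = r.1.2.1 ∨ q.1.2.2 = r.1.2.2) (Z : Idx K n → ℂ) :
    ∃ A B : ℂ, ∀ s t : ℂ, P K n (Z + s • Pi.single q 1 + t • Pi.single r 1) i =
      P K n Z i + s * A + t * B := by
  set N : Fin K → Matrix (Fin n) (Fin n) ℂ := fun L => (M L Z)⁻¹ with hN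
  set L := q.1.1 with hLq
  let D : Idx K n → Matrix (Fin n) (Fin n) ℂ := fun q => Matrix.single q.1.2.1 q.1.2.2 1
  -- The product `D u * N L * D v` is a matrix unit times one entry of `N L`. A common row or column
  -- turns the mixed entries into those for `u = v`, which vanish.
  have hz : ∀ u v : Idx K n, N L u.1.2.2 v.1.2.1 = 0 → D u * N L * D v = 0 := by
    intro u v h
    simp only [D]
    rw [Matrix.single_mul_mul_single, h]
    simp
  have hqq : N L q.1.2.2 q.1.2.1 = 0 := inv_M_apply_eq_zero _ Z q.2
  have hrr : N L r.1.2.2 r.1.2.1 = 0 := by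
    have := r.2
    rw [show r.1 = (r.1.1, r.1.2.1, r.1.2.2) from rfl, ← hL] at this
    exact inv_M_apply_eq_zero _ Z this
  have hqr : N L q.1.2.2 r.1.2.1 = 0 := by
    rcases hkl with h | h
    · rw [← h, hqq]
    · rw [h, hrr]
  have hrq : N L r.1.2.2 q.1.2.1 = 0 := by
    rcases hkl with h | h
    · rw [h, hrr]
    · rw [← h, hqq]
  have hM : ∀ (s t : ℂ) (L' : Fin K), M L' (Z + s • Pi.single q (1 : ℂ) + t • Pi.single r (1 : ℂ)) =
      M L' Z + if L' = L then s • D q + t • D r else 0 := by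
    intro s t L'
    rw [M_add_single, M_add_single, ← hL, ← hLq]
    by_cases h : L' = L
    · simp only [h, if_true, D]; rw [add_assoc]
    · simp [h]
  -- Only the factor `L` changes, and its inverse changes linearly in `s` and `t`; multilinearity of
  -- the product of all factors does the rest.
  have hinv : ∀ s t : ℂ, (fun L' => (M L' (Z + s • Pi.single q (1 : ℂ) + t • Pi.single r (1 : ℂ)))⁻¹) =
      Function.update N L (N L + (s • (-(N L * D q * N L)) + t • (-(N L * D r * N L)))) := by
    intro s t
    funext L'
    rw [hM]
    by_cases h : L' = L
    · rw [h, if_pos rfl, Function.update_self, inv_add_of_mul_inv_mul_eq_zero (isUnit_det_M _ _)]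
      · change N L - N L * (s • D q + t • D r) * N L = _
        simp only [mul_add, add_mul, Matrix.mul_smul, Matrix.smul_mul, smul_neg]
        abel
      · change (s • D q + t • D r) * N L * (s • D q + t • D r) = 0
        simp only [mul_add, add_mul, Matrix.mul_smul, Matrix.smul_mul, hz _ _ hqq, hz _ _ hqr,
          hz _ _ hrq, hz _ _ hrr, smul_zero, add_zero]
    · simp [h, hN]
  let Φ : MultilinearMap ℂ (fun _ : Fin K => Matrix (Fin n) (Fin n) ℂ) (Matrix (Fin n) (Fin n) ℂ) :=
    MultilinearMap.mkPiAlgebraFin ℂ K _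
  have hΦ : ∀ m, (List.ofFn m).prod = Φ m := fun m => (MultilinearMap.mkPiAlgebraFin_apply m).symm
  refine ⟨Matrix.vecMul (eLast n) (Φ (Function.update N L (-(N L * D q * N L)))) i,
    Matrix.vecMul (eLast n) (Φ (Function.update N L (-(N L * D r * N L)))) i, fun s t => ?_⟩
  have h1 : P K n Z i = Matrix.vecMul (eLast n) (Φ N) i := by rw [P, hΦ]
  rw [h1, P, hΦ, hinv, Φ.map_update_add, Φ.map_update_add, Φ.map_update_smul, Φ.map_update_smul,
    Function.update_eq_self]
  simp only [Matrix.vecMul_add, Matrix.vecMul_smul, Pi.add_apply, Pi.smul_apply, smul_eq_mul]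
  ring

theorem dP_eq_of_affine {i : Fin n} {q : Idx K n} {Z : Idx K n → ℂ} {A : ℂ}
    (h : ∀ s : ℂ, P K n (Z + s • Pi.single q 1) i = P K n Z i + s * A) : dP K n i q Z = A := by
  have hl := hasDerivAt_line Z (Pi.single q (1 : ℂ)) 0
  have h1 : HasFDerivAt (fun Z' => P K n Z' i) (fderiv ℂ (fun Z' => P K n Z' i) Z)
      (Z + (0 : ℂ) • Pi.single q (1 : ℂ)) := by
    rw [zero_smul, add_zero]
    exact (analyticAt_P i Z).differentiableAt.hasFDerivAt
  have h2 := h1.comp_hasDerivAt (0 : ℂ) hl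
  have h3 : HasDerivAt (fun s : ℂ => P K n Z i + s * A) A 0 := by
    simpa using ((hasDerivAt_id (0 : ℂ)).mul_const A).const_add (P K n Z i)
  refine h2.unique ?_
  simpa only [Function.comp_def, h] using h3

theorem P_add_single_add_single (i : Fin n) {q r : Idx K n} (hL : q.1.1 = r.1.1)
    (hkl : q.1.2.1 = r.1.2.1 ∨ q.1.2.2 = r.1.2.2) (Z : Idx K n → ℂ) (s t : ℂ) :
    P K n (Z + s • Pi.single q 1 + t • Pi.single r 1) i =
      P K n Z i + s * dP K n i q Z + t * dP K n i r Z := by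
  obtain ⟨A, B, h⟩ := exists_P_add_single_add_single i hL hkl Z
  have hA : dP K n i q Z = A := dP_eq_of_affine fun s => by simpa using h s 0
  have hB : dP K n i r Z = B := dP_eq_of_affine fun t => by simpa using h 0 t
  rw [hA, hB, h]

theorem P_add_single (i : Fin n) (q : Idx K n) (Z : Idx K n → ℂ) (s : ℂ) :
    P K n (Z + s • Pi.single q 1) i = P K n Z i + s * dP K n i q Z := by
  simpa using P_add_single_add_single i (q := q) (r := q) rfl (Or.inl rfl) Z s 0

theorem P_update (i : Fin n) (q : Idx K n) (Z : Idx K n → ℂ) (ζ : ℂ) :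
    P K n (Function.update Z q ζ) i = P K n Z i + (ζ - Z q) * dP K n i q Z := by
  rw [← P_add_single]
  congr 2
  funext r
  by_cases h : r = q
  · subst h; simp
  · simp [h]

/-- Without a mixed term the slopes of `P_i` in the directions `q` and `r` do not change when these
two variables move. This makes the pair field constant along its own lines. -/
theorem dP_add_single_add_single_left (i : Fin n) {q r : Idx K n} (hL : q.1.1 = r.1.1)
    (hkl : q.1.2.1 = r.1.2.1 ∨ q.1.2.2 = r.1.2.2) (Z : Idx K n → ℂ) (s t : ℂ) :
    dP K n i q (Z + s • Pi.single q 1 + t • Pi.single r 1) = dP K n i q Z := by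
  refine dP_eq_of_affine fun u => ?_
  have : Z + s • Pi.single q (1 : ℂ) + t • Pi.single r 1 + u • Pi.single q 1 =
      Z + (s + u) • Pi.single q 1 + t • Pi.single r 1 := by
    rw [add_smul]; abel
  rw [this, P_add_single_add_single i hL hkl, P_add_single_add_single i hL hkl]
  ring

theorem dP_add_single_add_single_right (i : Fin n) {q r : Idx K n} (hL : q.1.1 = r.1.1)
    (hkl : q.1.2.1 = r.1.2.1 ∨ q.1.2.2 = r.1.2.2) (Z : Idx K n → ℂ) (s t : ℂ) :
    dP K n i r (Z + s • Pi.single q 1 + t • Pi.single r 1) = dP K n i r Z := by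
  rw [add_right_comm]
  exact dP_add_single_add_single_left i hL.symm (hkl.imp Eq.symm Eq.symm) Z t s

theorem analyticAt_dP (i : Fin n) (q : Idx K n) (Z : Idx K n → ℂ) :
    AnalyticAt ℂ (dP K n i q) Z := by
  have h := (analyticAt_P i Z).fderiv
  exact (ContinuousLinearMap.apply ℂ ℂ (Pi.single q (1 : ℂ))).analyticAt _ |>.comp h

theorem exists_dP_ne_zero {i : Fin n} {Z : Idx K n → ℂ}
    (h : fderiv ℂ (fun Z' => P K n Z' i) Z ≠ 0) : ∃ q, dP K n i q Z ≠ 0 := by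
  by_contra! h0
  refine h (ContinuousLinearMap.coe_injective (LinearMap.pi_ext' fun q => LinearMap.ext_ring ?_))
  simpa [dP] using h0 q

theorem P_eq_vecMul_two (hK : 2 ≤ K) {Z : Idx K n → ℂ} (h : ∀ L : Fin K, 2 ≤ (L : ℕ) → M L Z = 1) :
    P K n Z = Matrix.vecMul (eLast n) ((M ⟨0, by omega⟩ Z)⁻¹ * (M ⟨1, by omega⟩ Z)⁻¹) := by
  obtain ⟨k, rfl⟩ := Nat.exists_eq_add_of_le' hK
  rw [P, List.ofFn_succ, List.ofFn_succ, List.prod_cons, List.prod_cons, List.prod_eq_one, mul_one]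
  · rfl
  · intro x hx
    obtain ⟨L, rfl⟩ := List.mem_ofFn' _ _ |>.1 hx
    beta_reduce
    rw [h _ (by simp), inv_one]

theorem M_zero (L : Fin K) : M L (0 : Idx K n → ℂ) = 1 := by
  ext k l
  simp [M, Matrix.one_apply]

end Fibration

/-! ### The pair fields on the fiber -/

section Fields

variable {K n : ℕ}

theorem add_smul_pairField (i : Fin n) (q r : Idx K n) (Z : Idx K n → ℂ) (τ : ℂ) :
    Z + τ • pairField K n i q r Z =
      Z + (τ * dP K n i r Z) • Pi.single q 1 + (-(τ * dP K n i q Z)) • Pi.single r 1 := by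
  rw [pairField, smul_sub, smul_smul, smul_smul, neg_smul]
  abel

theorem add_smul_pairField_mem_fiber {i : Fin n} {a : ℂ} {q r : Idx K n} (hL : q.1.1 = r.1.1)
    (hkl : q.1.2.1 = r.1.2.1 ∨ q.1.2.2 = r.1.2.2) {Z : Idx K n → ℂ} (hZ : Z ∈ fiber K n i a) (τ : ℂ) :
    Z + τ • pairField K n i q r Z ∈ fiber K n i a := by
  have hZ' : P K n Z i = a := hZ
  change P K n _ i = a
  rw [add_smul_pairField, P_add_single_add_single i hL hkl, hZ']
  ring

theorem pairField_add_smul (i : Fin n) {q r : Idx K n} (hL : q.1.1 = r.1.1)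
    (hkl : q.1.2.1 = r.1.2.1 ∨ q.1.2.2 = r.1.2.2) (Z : Idx K n → ℂ) (τ : ℂ) :
    pairField K n i q r (Z + τ • pairField K n i q r Z) = pairField K n i q r Z := by
  rw [add_smul_pairField]
  simp only [pairField, dP_add_single_add_single_left i hL hkl, dP_add_single_add_single_right i hL hkl]

/-- The field `pairField` on the fiber, for two variables of one factor that stand in the same row
or column. -/
noncomputable def pairHolVF (i : Fin n) (a : ℂ) (q r : Idx K n) (hL : q.1.1 = r.1.1)
    (hkl : q.1.2.1 = r.1.2.1 ∨ q.1.2.2 = r.1.2.2) : HolVF (fiber K n i a) where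
  toFun Z := pairField K n i q r Z
  holomorphic Z := ⟨pairField K n i q r,
    ((analyticAt_dP i r Z).smul analyticAt_const).sub ((analyticAt_dP i q Z).smul analyticAt_const),
    Eventually.of_forall fun _ => rfl⟩
  tangent Z := mem_tangentSpace_of_line fun τ => add_smul_pairField_mem_fiber hL hkl Z.2 τ

theorem pairHolVF_hasLinearFlow (i : Fin n) (a : ℂ) {q r : Idx K n} (hL : q.1.1 = r.1.1)
    (hkl : q.1.2.1 = r.1.2.1 ∨ q.1.2.2 = r.1.2.2) : (pairHolVF i a q r hL hkl).HasLinearFlow :=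
  ⟨fun Z τ => ⟨_, add_smul_pairField_mem_fiber hL hkl Z.2 τ⟩,
    fun Z τ => ⟨rfl, pairField_add_smul i hL hkl Z τ⟩⟩

theorem pairField_apply_of_ne (i : Fin n) {q r p : Idx K n} (hq : p ≠ q) (hr : p ≠ r)
    (Z : Idx K n → ℂ) : pairField K n i q r Z p = 0 := by
  simp [pairField, hq, hr]

theorem pairField_apply_right (i : Fin n) {q r : Idx K n} (h : q ≠ r) (Z : Idx K n → ℂ) :
    pairField K n i q r Z r = -dP K n i q Z := by
  simp [pairField, h.symm]

/-- Some point of the fiber has a non-zero derivative in the direction of `z_{1,n1}`. -/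
theorem exists_mem_fiber_dP_ne_zero (hn : 2 ≤ n) (hK : 2 ≤ K) (i : Fin n) (a : ℂ) :
    ∃ Z ∈ fiber K n i a, dP K n i (idx₁ hK 1 ⟨le_refl 1, by omega⟩) Z ≠ 0 := by
  set q : Idx K n := idx₁ hK 1 ⟨le_refl 1, by omega⟩ with hq
  -- `P_i` is affine in the variable `q`, so a non-zero slope allows it to reach the value `a`, and
  -- the slope is unchanged on the way.
  suffices h : ∃ Z, dP K n i q Z ≠ 0 by
    obtain ⟨Z, hZ⟩ := h
    refine ⟨Z + ((a - P K n Z i) / dP K n i q Z) • Pi.single q 1, ?_, ?_⟩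
    · change P K n _ i = a
      rw [P_add_single]
      field_simp
      ring
    · have := dP_add_single_add_single_left i (q := q) (r := q) rfl (Or.inl rfl) Z
        ((a - P K n Z i) / dP K n i q Z) 0
      rw [zero_smul, add_zero] at this
      rwa [this]
  let o : Fin n := ⟨0, by omega⟩
  let l : Fin n := ⟨n - 1, by omega⟩
  have hol : o ≠ l := by simp [o, l]; omega
  -- With all factors but the second trivial, the slope is minus the entry `(1, i)` of `M_2⁻¹`. It
  -- is non-zero for `M_2 = 1` if `i = 1`, and otherwise after setting `z_{2,1i} = 1`.
  have key : ∀ Z : Idx K n → ℂ, M ⟨0, by omega⟩ Z = 1 → (∀ L : Fin K, 2 ≤ (L : ℕ) → M L Z = 1) →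
      dP K n i q Z = -(M ⟨1, by omega⟩ Z)⁻¹ o i := by
    intro Z h0 h2
    have hM : ∀ L : Fin K, M L (Z + (1 : ℂ) • Pi.single q 1) =
        M L Z + if L = ⟨0, by omega⟩ then Matrix.single l o (1 : ℂ) else 0 := by
      intro L
      rw [M_add_single, one_smul]
      rfl
    have h3 := P_add_single i q Z 1
    rw [P_eq_vecMul_two hK h2, P_eq_vecMul_two hK (fun L hL => by
      rw [hM, if_neg (by rintro rfl; simp at hL), add_zero, h2 L hL]), hM, hM, h0, if_pos rfl,
      if_neg (by simp), inv_add_of_mul_inv_mul_eq_zero (by simp)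
        (by simp [Matrix.single_mul_single_of_ne _ _ _ _ hol])] at h3
    simp only [inv_one, one_mul, mul_one, add_zero, sub_mul, Matrix.vecMul_sub, Pi.sub_apply] at h3
    have h4 : Matrix.vecMul (eLast n) (Matrix.single l o (1 : ℂ) * (M ⟨1, by omega⟩ Z)⁻¹) i =
        (M ⟨1, by omega⟩ Z)⁻¹ o i := by
      rw [Matrix.vecMul, dotProduct, Finset.sum_eq_single l]
      · have : eLast n l = 1 := by
          simp only [eLast, l]
          rw [if_pos (by omega)]
        rw [this]
        simp
      · intro k _ hk
        simp [hk]
      · simp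
    rw [h4] at h3
    linear_combination -h3
  by_cases hi : i = o
  · refine ⟨0, ?_⟩
    rw [key 0 (M_zero _) fun L _ => M_zero _, M_zero, hi]
    simp
  · have hpos : IsPos K n (⟨1, by omega⟩, o, i) := by
      have : (i : ℕ) ≠ 0 := fun h => hi (Fin.ext h)
      simp only [IsPos, Nat.not_even_one, if_false, o, Fin.lt_def]
      omega
    let p : Idx K n := ⟨(⟨1, by omega⟩, o, i), hpos⟩
    have hM : ∀ L : Fin K, M L (0 + (1 : ℂ) • Pi.single p 1) =
        1 + if L = ⟨1, by omega⟩ then Matrix.single o i (1 : ℂ) else 0 := by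
      intro L
      rw [M_add_single, one_smul, M_zero]
    refine ⟨0 + (1 : ℂ) • Pi.single p 1, ?_⟩
    rw [key _ (by rw [hM, if_neg (by simp), add_zero]) fun L hL => by
      rw [hM, if_neg (by rintro rfl; simp at hL), add_zero], hM, if_pos rfl,
      inv_add_of_mul_inv_mul_eq_zero (by simp) (by simp [Matrix.single_mul_single_of_ne _ _ _ _ hi])]
    simp [Ne.symm hi]

/-- The closure of the polynomials on a smooth fiber is the whole algebra `𝒪(𝒢)`. -/
theorem mem_closure_polyFun_fiber {i : Fin n} {a : ℂ}
    (hsmooth : ∀ Z ∈ fiber K n i a, fderiv ℂ (fun Z' => P K n Z' i) Z ≠ 0)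
    (f : HolFun (fiber K n i a)) : f ∈ closure (Set.range (polyFun (fiber K n i a))) := by
  refine mem_closure_range_polyFun (F := fun Z => P K n Z i - a) (A := dP K n i)
    (fun Z => sub_eq_zero.symm) ((contDiff_P i 1).sub contDiff_const)
    (fun q => continuous_iff_continuousAt.2 fun Z => (analyticAt_dP i q Z).continuousAt)
    (fun q Z ζ => ?_) (fun Z hZ => exists_dP_ne_zero (hsmooth Z (sub_eq_zero.1 hZ))) f
  rw [P_update]
  ring

end Fields

/-! ### The two-vertex tree and the compatible pair -/

theorem oneEdge_isRootedTree : IsRootedTree oneEdge 0 where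
  root_out w h := by simpa [oneEdge] using h.1
  out_unique v hv := ⟨0, ⟨by omega, rfl⟩, fun w hw => hw.2⟩
  reach v := by
    by_cases h : v = 0
    · rw [h]
    · exact Relation.ReflTransGen.single ⟨by omega, rfl⟩

/-- Two fields form an admissible rooted tree as soon as an edge function exists. -/
theorem isAdmissibleTree_pair {E : Type} [NormedAddCommGroup E] [NormedSpace ℂ E] {X : Set E}
    {V W : HolVF X} {f : HolFun X} (hf : f ∈ edgeFunctions V W) :
    IsAdmissibleTree ![W, V] oneEdge 0 ![W, V] fun _ _ => f where
  tree := oneEdge_isRootedTree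
  bij := by
    -- An edge function lies in the kernel of `W` but not of `V`, so the labelling is injective.
    have hne : W ≠ V := fun h => hf.2.1 (h ▸ hf.2.2)
    rw [← Set.image_univ]
    refine Set.InjOn.bijOn_image fun v _ w _ h => ?_
    fin_cases v <;> fin_cases w <;> simp_all [Ne.symm]
  root_eq := rfl
  edge v w h := by
    obtain ⟨rfl, rfl⟩ := h
    exact hf

end GromovVaserstein

theorem mainTheorem9 (n K : ℕ) (hn : 3 ≤ n) (hK : 2 ≤ K) (i : Fin n) (a : ℂ) (ha : a ≠ 0)
    (hsmooth : ∀ Z ∈ fiber K n i a, fderiv ℂ (fun Z' => P K n Z' i) Z ≠ 0) :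
    ∃ V₁ V₂ : HolVF (fiber K n i a),
      (∀ Z, V₁.toFun Z =
        pairField K n i (idx₁ hK 1 ⟨le_refl 1, by omega⟩) (idx₁ hK 2 ⟨by omega, by omega⟩) Z) ∧
      (∀ Z, V₂.toFun Z =
        pairField K n i (idx₂ hK 1 ⟨le_refl 1, by omega⟩) (idx₂ hK 2 ⟨by omega, by omega⟩) Z) ∧
      IsLocallyNilpotent V₁ ∧ IsLocallyNilpotent V₂ ∧
      V₁.IsComplete ∧ V₂.IsComplete ∧
      IsCompatible ![V₂, V₁] ∧
      ∃ f : HolFun (fiber K n i a),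
        (∀ Z, f.1 Z = Z.1 (idx₁ hK 2 ⟨by omega, by omega⟩)) ∧
        IsAdmissibleTree ![V₂, V₁] oneEdge 0 ![V₂, V₁] (fun _ _ => f) := by
  set q₁ : Idx K n := idx₁ hK 1 ⟨le_refl 1, by omega⟩ with hq₁
  set r₁ : Idx K n := idx₁ hK 2 ⟨by omega, by omega⟩ with hr₁
  set q₂ : Idx K n := idx₂ hK 1 ⟨le_refl 1, by omega⟩ with hq₂
  set r₂ : Idx K n := idx₂ hK 2 ⟨by omega, by omega⟩ with hr₂
  have hqr₁ : q₁ ≠ r₁ := by simp [hq₁, hr₁, idx₁]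
  have h12 : q₁ ≠ q₂ ∧ q₁ ≠ r₂ ∧ r₁ ≠ q₂ ∧ r₁ ≠ r₂ := by
    simp [hq₁, hr₁, hq₂, hr₂, idx₁, idx₂]
  set V₁ : HolVF (fiber K n i a) := pairHolVF i a q₁ r₁ rfl (Or.inl rfl) with hV₁
  set V₂ : HolVF (fiber K n i a) := pairHolVF i a q₂ r₂ rfl (Or.inr rfl) with hV₂
  have hflow₁ : V₁.HasLinearFlow := pairHolVF_hasLinearFlow i a _ _
  have hflow₂ : V₂.HasLinearFlow := pairHolVF_hasLinearFlow i a _ _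
  obtain ⟨Z₀, hZ₀, hdP⟩ := exists_mem_fiber_dP_ne_zero (by omega) hK i a
  set f := polyFun (fiber K n i a) (MvPolynomial.X r₁) with hf
  have hf₁ : ∀ Z, (V₁.lie f).1 Z = -dP K n i q₁ Z := fun Z => by
    rw [hf, V₁.lie_polyFun_X]
    exact pairField_apply_right i hqr₁ Z
  have hedge : f ∈ edgeFunctions V₁ V₂ := by
    refine ⟨?_, fun h => ?_, ?_⟩
    -- `V₁ f` is a component of `V₁` itself, hence constant along the flow of `V₁`.
    · obtain ⟨γ, hγ⟩ := hflow₁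
      refine HolVF.lie_eq_zero_of_flow hγ fun Z τ => ?_
      rw [hf, V₁.lie_polyFun_X, V₁.lie_polyFun_X, (hγ Z τ).2]
    · have := hf₁ ⟨Z₀, hZ₀⟩
      rw [h] at this
      exact hdP (neg_eq_zero.1 this.symm)
    · ext Z
      rw [hf, V₂.lie_polyFun_X]
      exact pairField_apply_of_ne i h12.2.2.1 h12.2.2.2 Z
  have hcompl : ∀ j, (![V₂, V₁] j).IsComplete := by
    intro j
    fin_cases j
    exacts [hflow₂.isComplete, hflow₁.isComplete]
  refine ⟨V₁, V₂, fun _ => rfl, fun _ => rfl, hflow₁.isLocallyNilpotent, hflow₂.isLocallyNilpotent,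
    hflow₁.isComplete, hflow₂.isComplete, ⟨hcompl, ⟨⊤, ?_, fun g _ => ?_⟩,
      ⟨_, _, _, _, _, isAdmissibleTree_pair hedge⟩⟩, f, fun Z => ?_, isAdmissibleTree_pair hedge⟩
  · intro h
    have h1 : (1 : HolFun (fiber K n i a)) = 0 := by
      rw [← Ideal.mem_bot, ← h]
      trivial
    have h2 := congrArg (fun g : HolFun (fiber K n i a) => g.1 ⟨Z₀, hZ₀⟩) h1
    exact one_ne_zero (α := ℂ) h2
  · refine closure_mono ?_ (mem_closure_polyFun_fiber hsmooth g)
    rintro _ ⟨p, rfl⟩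
    refine polyFun_mem_of_monomial (fun m c => Submodule.subset_span ?_) p
    -- The tuple starts with the root `V₂`, so the first factor is the one free of `z_{2,1n}` and
    -- `z_{2,2n}`; it also carries the coefficient `c`.
    refine ⟨![polyFun _ (MvPolynomial.monomial (m.filter fun j => ¬ (j = q₂ ∨ j = r₂)) c),
      polyFun _ (MvPolynomial.monomial (m.filter fun j => j = q₂ ∨ j = r₂) 1)], fun j => ?_, ?_⟩
    · fin_cases j
      · refine hflow₂.lie_monomial (fun j hj Z => ?_) c
        rw [Finsupp.support_filter, Finset.mem_filter, not_or] at hj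
        exact pairField_apply_of_ne i hj.2.1 hj.2.2 Z
      · refine hflow₁.lie_monomial (fun j hj Z => ?_) 1
        rw [Finsupp.support_filter, Finset.mem_filter] at hj
        rcases hj.2 with rfl | rfl
        exacts [pairField_apply_of_ne i h12.1.symm h12.2.2.1.symm Z,
          pairField_apply_of_ne i h12.2.1.symm h12.2.2.2.symm Z]
    · rw [Fin.prod_univ_two]
      ext Z
      change MvPolynomial.eval Z.1 _ = MvPolynomial.eval Z.1 _ * MvPolynomial.eval Z.1 _
      rw [← map_mul, MvPolynomial.monomial_mul, mul_one, add_comm, Finsupp.filter_add_filter_not]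
  · exact MvPolynomial.eval_X r₁
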